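/- Let $M\subset\mathbb{R}^d$ be a compact $d'$-dimensional $\mathcal{C}^2$ submanifold, possibly with boundary $\partial M$, with the Riemannian metric inherited from $\mathbb{R}^d$ and geodesic distance $\rho$. Let $X,X_1,X_2,\dots$ be iid random vectors with support $M$, whose law has a density $f:M\to[0,\infty)$ of class $\mathcal{C}^2$ with respect to the Riemannian volume of $M$ (the normalized $d'$-dimensional Hausdorff measure). Let $h=h_n>0$ with $h_n\to0$ and let $\beta_n\to\infty$ be such that $\beta_nh_n^2\to0$ and $nh_n^{d'}/(\beta_n^2\log n)\to\infty$. For $x\in M$ put $$\hat f_{n,h}(x)=\frac1{n\,h_n^{d'}}\sum_{i=1}^n K\Big(\frac{\|x-X_i\|}{h_n}\Big),\qquad K(t)=\pi^{-d'/2}e^{-t^2},$$ and, for $g:M\to\mathbb{R}$, let $L_g(\lambda)=\{x\in M: g(x)\ge\lambda\}$. Let $\lambda>0$ be such that for every $x\in M$ with $f(x)=\lambda$ there is a sequence $a_j\to x$ of points of $M\setminus\partial M$ with $f(a_j)>\lambda$ for all $j$. Then, almost surely, $$d_H\big(L_{\hat f_{n,h}}(\lambda),L_f(\lambda)\big)\to0\quad\text{as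 } n\to\infty,$$ where $d_H(A,C)=\max\{\sup_{a\in A}\inf_{c\in C}\rho(a,c),\ \sup_{c\in C}\inf_{a\in A}\rho(c,a)\}\in[0,\infty]$ is the Hausdorff distance with respect to $\rho$ (with $\rho(x,y)=\infty$ if $x,y$ lie in different components of $M$, $d_H(\emptyset,\emptyset)=0$, and $d_H(A,C)=\infty$ if exactly one of $A,C$ is empty). -/

import Mathlib

open Set Filter Topology MeasureTheory ProbabilityTheory
open scoped ENNReal

noncomputable section

namespace ManifoldDensity

/-- The flat model inside `ℝ^d` of an `m`-dimensional manifold with boundary: the closed half-space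
`{y₀ ≥ 0}` of `ℝ^m × {0}` (for `m = 0` it is the single point `0`). -/
def halfModel (d m : ℕ) : Set (EuclideanSpace ℝ (Fin d)) :=
  {y | (∀ i : Fin d, m ≤ i.val → y i = 0) ∧ (∀ i : Fin d, i.val = 0 → 0 ≤ y i)}

/-- The part `{y₀ > 0}` of the model that is off its boundary hyperplane (for `m = 0` there is no
boundary, and this is all of the model). -/
def halfModelInterior (d m : ℕ) : Set (EuclideanSpace ℝ (Fin d)) :=
  {y | y ∈ halfModel d m ∧ ∀ i : Fin d, i.val = 0 → i.val < m → 0 < y i}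

/-- `Φ` is a `C²` diffeomorphism between open subsets of `ℝ^d`, defined near `x`, which straightens
`M` to the model half-space. -/
structure IsAdaptedChart {d : ℕ} (m : ℕ) (M : Set (EuclideanSpace ℝ (Fin d)))
    (x : EuclideanSpace ℝ (Fin d))
    (Φ : OpenPartialHomeomorph (EuclideanSpace ℝ (Fin d)) (EuclideanSpace ℝ (Fin d))) : Prop where
  mem_source : x ∈ Φ.source
  contDiffOn : ContDiffOn ℝ 2 Φ Φ.source
  contDiffOn_symm : ContDiffOn ℝ 2 Φ.symm Φ.target
  mem_iff : ∀ y ∈ Φ.source, (Φ y ∈ halfModel d m ↔ y ∈ M)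

/-- `M` is an `m`-dimensional embedded `C²` submanifold, possibly with boundary, of `ℝ^d`. -/
structure IsC2Submanifold {d : ℕ} (m : ℕ) (M : Set (EuclideanSpace ℝ (Fin d))) : Prop where
  dim_le : m ≤ d
  exists_chart : ∀ x ∈ M, ∃ Φ, IsAdaptedChart m M x Φ

/-- The interior `M \ ∂M` of `M` as a manifold with boundary: the points that some adapted chart
sends off the boundary hyperplane. -/
def manifoldInterior {d : ℕ} (m : ℕ) (M : Set (EuclideanSpace ℝ (Fin d))) :
    Set (EuclideanSpace ℝ (Fin d)) :=
  {x | x ∈ M ∧ ∃ Φ, IsAdaptedChart m M x Φ ∧ Φ x ∈ halfModelInterior d m}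

/-- `f` is of class `C²` on `M`: locally it is the restriction of a `C²` function on an open subset
of the ambient space. -/
def IsC2On {d : ℕ} (M : Set (EuclideanSpace ℝ (Fin d))) (f : EuclideanSpace ℝ (Fin d) → ℝ) :
    Prop :=
  ∀ x ∈ M, ∃ U : Set (EuclideanSpace ℝ (Fin d)), IsOpen U ∧ x ∈ U ∧
    ∃ g : EuclideanSpace ℝ (Fin d) → ℝ, ContDiffOn ℝ 2 g U ∧ ∀ y ∈ U ∩ M, g y = f y

/-- The Riemannian volume of an `m`-dimensional submanifold `M` of `ℝ^d`, for the metric inherited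
from `ℝ^d`: the `m`-dimensional Hausdorff measure, normalized so that it is Lebesgue measure on
`ℝ^m`, restricted to `M`. -/
def volumeOn {d : ℕ} (m : ℕ) (M : Set (EuclideanSpace ℝ (Fin d))) :
    Measure (EuclideanSpace ℝ (Fin d)) :=
  (Measure.euclideanHausdorffMeasure m).restrict M

/-- The length of a curve `γ` over `[0, 1]`. -/
def curveLength {d : ℕ} (γ : ℝ → EuclideanSpace ℝ (Fin d)) : ℝ≥0∞ :=
  ∫⁻ t in Icc (0 : ℝ) 1, ‖derivWithin γ (Icc (0 : ℝ) 1) t‖ₑ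

/-- The geodesic distance `ρ(x, y)` of `M`: the infimum of the lengths of the `C¹` curves in `M`
from `x` to `y` (it is `∞` if there is no such curve). -/
def geodesicDist {d : ℕ} (M : Set (EuclideanSpace ℝ (Fin d))) (x y : EuclideanSpace ℝ (Fin d)) :
    ℝ≥0∞ :=
  ⨅ (γ : ℝ → EuclideanSpace ℝ (Fin d)) (_ : ContDiffOn ℝ 1 γ (Icc (0 : ℝ) 1))
    (_ : MapsTo γ (Icc (0 : ℝ) 1) M) (_ : γ 0 = x) (_ : γ 1 = y), curveLength γ

/-- The Hausdorff distance of two subsets of `M`, with respect to the geodesic distance of `M`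
(it is `0` if both sets are empty, and `∞` if exactly one of them is). -/
def hausdorffDist {d : ℕ} (M A C : Set (EuclideanSpace ℝ (Fin d))) : ℝ≥0∞ :=
  (⨆ a ∈ A, ⨅ c ∈ C, geodesicDist M a c) ⊔ (⨆ c ∈ C, ⨅ a ∈ A, geodesicDist M c a)

/-- The level set `L_g(lam) = {x ∈ M : g(x) ≥ lam}`. -/
def levelSet {d : ℕ} (M : Set (EuclideanSpace ℝ (Fin d))) (g : EuclideanSpace ℝ (Fin d) → ℝ)
    (lam : ℝ) : Set (EuclideanSpace ℝ (Fin d)) :=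
  {x | x ∈ M ∧ lam ≤ g x}

/-- The Gaussian kernel `K(t) = π^(-m/2) exp(-t²)`, which integrates to one over `ℝ^m`. -/
def gaussKernel (m : ℕ) (t : ℝ) : ℝ :=
  Real.pi ^ (-(m : ℝ) / 2) * Real.exp (-t ^ 2)

/-- The kernel density estimator with bandwidth `h` that is built from the first `n` observations
of the sample `x 0, x 1, …`. -/
def kernelEstimator {d : ℕ} (m n : ℕ) (h : ℝ) (x : ℕ → EuclideanSpace ℝ (Fin d))
    (p : EuclideanSpace ℝ (Fin d)) : ℝ :=
  1 / (n * h ^ m) * ∑ i ∈ Finset.range n, gaussKernel m (‖p - x i‖ / h)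

end ManifoldDensity

end

namespace ManifoldDensity

/-! By compactness of `M`, two one-sided facts suffice (`tendsto_hausdorffDist_levelSet`). If the
estimator is eventually below `lam` on each set `{f ≤ lam - ε}`, its level set stays in any
`δ`-neighbourhood of that of `f`, since `f` has a maximum below `lam` on the points at distance at
least `δ`. If the estimator is eventually at least `lam` at each point of a set `D ⊆ M` whose
closure contains the level set of `f`, then finitely many `δ`-balls centred in `D` cover that level
set. Charts make the geodesic distance uniformly small at small ambient distance
(`exists_geodesicDist_le`).

The asymmetry comes from `∂M`, where the kernel loses part of its mass: the mean of the estimator is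
at most `f + ε` uniformly on `M` (`eventually_kernelMean_le`), but nearly `f` from below only at
interior points (`eventually_le_kernelMean`). The hypothesis on the level provides a suitable `D` of
interior points with `f > lam`. Both mean bounds come from maps to `ℝ^m` distorting distances by at
most `1 + η`, under which kernel and Hausdorff measure each change by a factor of at most `(1 +
η)^m`.

Fluctuations obey Chernoff bounds exponential in `n h^m`, which beats `log n`. Hence they are
summable even after a union over a net of polynomial size, and Borel–Cantelli applies. The Lipschitz
bound for the estimator passes from the net to all points. -/

lemma convex_halfModel (d m : ℕ) : Convex ℝ (halfModel d m) := by
  rintro x ⟨hx, hx'⟩ y ⟨hy, hy'⟩ a b ha hb -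
  refine ⟨fun i hi => by simp [hx i hi, hy i hi], fun i hi => ?_⟩
  have := hx' i hi
  have := hy' i hi
  simp only [PiLp.add_apply, PiLp.smul_apply, smul_eq_mul]
  positivity

/-! ### Adapted charts: local geodesic distance and density of the interior. -/

section Chart

variable {d m : ℕ} {M : Set (EuclideanSpace ℝ (Fin d))} {x : EuclideanSpace ℝ (Fin d)}
  {Φ : OpenPartialHomeomorph (EuclideanSpace ℝ (Fin d)) (EuclideanSpace ℝ (Fin d))}

lemma IsAdaptedChart.of_mem_source (hΦ : IsAdaptedChart m M x Φ) {y : EuclideanSpace ℝ (Fin d)}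
    (hy : y ∈ Φ.source) : IsAdaptedChart m M y Φ :=
  ⟨hy, hΦ.contDiffOn, hΦ.contDiffOn_symm, hΦ.mem_iff⟩

lemma IsAdaptedChart.apply_mem_target (hΦ : IsAdaptedChart m M x Φ) : Φ x ∈ Φ.target :=
  Φ.map_source hΦ.mem_source

lemma IsAdaptedChart.symm_mem_iff (hΦ : IsAdaptedChart m M x Φ) {u : EuclideanSpace ℝ (Fin d)}
    (hu : u ∈ Φ.target) : Φ.symm u ∈ M ↔ u ∈ halfModel d m := by
  rw [← hΦ.mem_iff _ (Φ.map_target hu), Φ.right_inv hu]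

lemma IsAdaptedChart.contDiffAt_symm (hΦ : IsAdaptedChart m M x Φ)
    {u : EuclideanSpace ℝ (Fin d)} (hu : u ∈ Φ.target) : ContDiffAt ℝ 2 Φ.symm u :=
  (hΦ.contDiffOn_symm u hu).contDiffAt (Φ.open_target.mem_nhds hu)

lemma IsAdaptedChart.contDiffAt (hΦ : IsAdaptedChart m M x Φ) : ContDiffAt ℝ 2 Φ x :=
  (hΦ.contDiffOn x hΦ.mem_source).contDiffAt (Φ.open_source.mem_nhds hΦ.mem_source)

lemma IsAdaptedChart.continuousAt (hΦ : IsAdaptedChart m M x Φ) : ContinuousAt Φ x :=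
  hΦ.contDiffAt.continuousAt

lemma IsAdaptedChart.continuousAt_symm (hΦ : IsAdaptedChart m M x Φ)
    {u : EuclideanSpace ℝ (Fin d)} (hu : u ∈ Φ.target) : ContinuousAt Φ.symm u :=
  (hΦ.contDiffAt_symm hu).continuousAt

/-- Inside one chart, the geodesic distance is small near the centre. -/
lemma IsAdaptedChart.eventually_geodesicDist_le (hΦ : IsAdaptedChart m M x Φ) {ε : ℝ}
    (hε : 0 < ε) : ∃ U : Set (EuclideanSpace ℝ (Fin d)), IsOpen U ∧ x ∈ U ∧
      ∀ p ∈ M ∩ U, ∀ q ∈ M ∩ U, geodesicDist M p q ≤ ENNReal.ofReal ε := by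
  set u₀ := Φ x
  have hu₀ : u₀ ∈ Φ.target := hΦ.apply_mem_target
  set C : ℝ := ‖fderiv ℝ Φ.symm u₀‖ + 1
  have hC : 0 < C := by positivity
  have h1 : ∀ᶠ u in 𝓝 u₀, u ∈ Φ.target ∧ ‖fderiv ℝ Φ.symm u‖ < C :=
    (Φ.open_target.eventually_mem hu₀).and
      (((hΦ.contDiffAt_symm hu₀).continuousAt_fderiv (by norm_num)).norm.eventually_lt_const
        (by simp [C]))
  obtain ⟨r, hr, hball⟩ := Metric.eventually_nhds_iff_ball.1 h1
  -- Chart segments inside the `s`-ball are shorter than `2 s ≤ ε / C`, and `Φ.symm` stretches them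
  -- by at most `C`.
  set s := min r (ε / (2 * C))
  have hs : 0 < s := lt_min hr (by positivity)
  have h2 : ∀ᶠ y in 𝓝 x, y ∈ Φ.source ∧ Φ y ∈ Metric.ball u₀ s :=
    (Φ.open_source.eventually_mem hΦ.mem_source).and
      (hΦ.continuousAt (Metric.ball_mem_nhds _ hs))
  obtain ⟨U, hU, hUo, hxU⟩ := eventually_nhds_iff.1 h2
  refine ⟨U, hUo, hxU, ?_⟩
  rintro p ⟨hpM, hpU⟩ q ⟨hqM, hqU⟩
  obtain ⟨hps, hpb⟩ := hU p hpU
  obtain ⟨hqs, hqb⟩ := hU q hqU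
  set L : ℝ → EuclideanSpace ℝ (Fin d) := fun t => AffineMap.lineMap (Φ p) (Φ q) t
  have hLball : ∀ t ∈ Icc (0 : ℝ) 1, L t ∈ Metric.ball u₀ s := fun t ht =>
    (convex_ball u₀ s).lineMap_mem hpb hqb ht
  have hLt : ∀ t ∈ Icc (0 : ℝ) 1, L t ∈ Φ.target ∧ ‖fderiv ℝ Φ.symm (L t)‖ < C := fun t ht =>
    hball _ (Metric.ball_subset_ball (min_le_left _ _) (hLball t ht))
  have hLd : ∀ t, HasDerivAt L (Φ q - Φ p) t := fun t => AffineMap.hasDerivAt_lineMap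
  have hLc : ContDiff ℝ 1 L := by
    have : L = fun t => t • (Φ q - Φ p) + Φ p := by
      ext1 t; simp [L, AffineMap.lineMap_apply]
    rw [this]
    fun_prop
  have hγ : ContDiffOn ℝ 1 (fun t => Φ.symm (L t)) (Icc (0 : ℝ) 1) :=
    (hΦ.contDiffOn_symm.of_le (by norm_num)).comp hLc.contDiffOn fun t ht => (hLt t ht).1
  have hmaps : MapsTo (fun t => Φ.symm (L t)) (Icc (0 : ℝ) 1) M := fun t ht =>
    (hΦ.symm_mem_iff (hLt t ht).1).2 <| (convex_halfModel d m).lineMap_mem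
      ((hΦ.mem_iff p hps).2 hpM) ((hΦ.mem_iff q hqs).2 hqM) ht
  have hbound : ∀ t ∈ Icc (0 : ℝ) 1,
      ‖derivWithin (fun t => Φ.symm (L t)) (Icc (0 : ℝ) 1) t‖ₑ ≤ ENNReal.ofReal ε := by
    intro t ht
    have hd : HasDerivAt (fun t => Φ.symm (L t)) (fderiv ℝ Φ.symm (L t) (Φ q - Φ p)) t :=
      HasFDerivAt.comp_hasDerivAt t
        ((hΦ.contDiffAt_symm (hLt t ht).1).differentiableAt (by norm_num)).hasFDerivAt (hLd t)
    rw [hd.hasDerivWithinAt.derivWithin (uniqueDiffOn_Icc zero_lt_one t ht), ← ofReal_norm]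
    apply ENNReal.ofReal_le_ofReal
    have hpq : ‖Φ q - Φ p‖ ≤ ε / C := by
      rw [← dist_eq_norm]
      calc dist (Φ q) (Φ p) ≤ dist (Φ q) u₀ + dist (Φ p) u₀ := dist_triangle_right _ _ _
        _ ≤ ε / (2 * C) + ε / (2 * C) := by
          have := min_le_right r (ε / (2 * C))
          rw [Metric.mem_ball] at hpb hqb
          linarith
        _ = ε / C := by field_simp; ring
    calc _ ≤ ‖fderiv ℝ Φ.symm (L t)‖ * ‖Φ q - Φ p‖ := ContinuousLinearMap.le_opNorm _ _
      _ ≤ C * (ε / C) := by gcongr; exact (hLt t ht).2.le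
      _ = ε := by field_simp
  calc geodesicDist M p q ≤ curveLength fun t => Φ.symm (L t) := by
        refine iInf₂_le_of_le _ hγ (iInf₂_le_of_le hmaps ?_ (iInf_le_of_le ?_ le_rfl))
        · simp [L, Φ.left_inv hps]
        · simp [L, Φ.left_inv hqs]
    _ ≤ ∫⁻ t in Icc (0 : ℝ) 1, ENNReal.ofReal ε :=
        setLIntegral_mono' measurableSet_Icc hbound
    _ = ENNReal.ofReal ε := by simp

/-- Points of `M` are limits of interior points. -/
lemma IsAdaptedChart.mem_closure_manifoldInterior (hΦ : IsAdaptedChart m M x Φ) (hx : x ∈ M)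
    (hm : m ≤ d) : x ∈ closure (manifoldInterior m M) := by
  by_cases hm0 : m = 0
  · exact subset_closure ⟨hx, Φ, hΦ, (hΦ.mem_iff x hΦ.mem_source).2 hx, fun i _ hi => by omega⟩
  have hd : 0 < d := by omega
  -- The inward direction of the half-space: moving along it leaves the boundary hyperplane at once.
  set e : EuclideanSpace ℝ (Fin d) := EuclideanSpace.single ⟨0, hd⟩ 1
  set u₀ := Φ x
  have hu₀ : u₀ ∈ Φ.target := hΦ.apply_mem_target
  have hc : Tendsto (fun t : ℝ => u₀ + t • e) (𝓝[>] 0) (𝓝 u₀) := by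
    have : Continuous fun t : ℝ => u₀ + t • e := by fun_prop
    simpa using (this.tendsto 0).mono_left nhdsWithin_le_nhds
  have hlim : Tendsto (fun t : ℝ => Φ.symm (u₀ + t • e)) (𝓝[>] 0) (𝓝 x) := by
    have := (hΦ.continuousAt_symm hu₀).tendsto.comp hc
    rwa [Φ.left_inv hΦ.mem_source] at this
  refine mem_closure_of_tendsto hlim ?_
  filter_upwards [hc (Φ.open_target.mem_nhds hu₀), self_mem_nhdsWithin] with t ht ht0
  have ht0 : 0 < t := ht0
  obtain ⟨h1, h2⟩ := (hΦ.mem_iff x hΦ.mem_source).2 hx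
  have hmod : u₀ + t • e ∈ halfModelInterior d m := by
    have key : ∀ i : Fin d, i.val = 0 → 0 < (u₀ + t • e) i := by
      intro i hi
      have hi' : i = ⟨0, hd⟩ := Fin.ext hi
      have := h2 i hi
      subst hi'
      simp [e]
      linarith
    refine ⟨⟨fun i hi => ?_, fun i hi => (key i hi).le⟩, fun i hi _ => key i hi⟩
    have hne : i ≠ ⟨0, hd⟩ := fun h => by rw [h] at hi; simp at hi; omega
    simp [e, hne, u₀, h1 i hi]
  refine ⟨(hΦ.symm_mem_iff ht).2 hmod.1, Φ, hΦ.of_mem_source (Φ.map_target ht), ?_⟩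
  rwa [Φ.right_inv ht]

end Chart

/-! ### Compactness and the deterministic criterion for level sets. -/

section Global

variable {d m : ℕ} {M : Set (EuclideanSpace ℝ (Fin d))} {f : EuclideanSpace ℝ (Fin d) → ℝ}

lemma IsC2On.continuousOn (hf : IsC2On M f) : ContinuousOn f M := by
  intro x hx
  obtain ⟨U, hU, hxU, g, hg, hgf⟩ := hf x hx
  have hg' : ContinuousWithinAt g M x :=
    (hg.continuousOn.continuousAt (hU.mem_nhds hxU)).continuousWithinAt
  refine hg'.congr_of_eventuallyEq ?_ (hgf x ⟨hxU, hx⟩).symm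
  filter_upwards [self_mem_nhdsWithin, nhdsWithin_le_nhds (hU.mem_nhds hxU)] with y hy hyU
  exact (hgf y ⟨hyU, hy⟩).symm

/-- On a compact submanifold the geodesic distance is uniformly controlled by the ambient one. -/
lemma exists_geodesicDist_le (hM : IsC2Submanifold m M) (hMc : IsCompact M) {ε : ℝ}
    (hε : 0 < ε) : ∃ δ > 0, ∀ p ∈ M, ∀ q ∈ M, dist q p < δ →
      geodesicDist M p q ≤ ENNReal.ofReal ε := by
  have : ∀ x : M, ∃ U : Set (EuclideanSpace ℝ (Fin d)), IsOpen U ∧ x.1 ∈ U ∧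
      ∀ p ∈ M ∩ U, ∀ q ∈ M ∩ U, geodesicDist M p q ≤ ENNReal.ofReal ε := fun x => by
    obtain ⟨Φ, hΦ⟩ := hM.exists_chart x x.2
    exact hΦ.eventually_geodesicDist_le hε
  choose U hUo hxU hU using this
  obtain ⟨δ, hδ, H⟩ := lebesgue_number_lemma_of_metric hMc hUo
    (fun x hx => mem_iUnion.2 ⟨⟨x, hx⟩, hxU ⟨x, hx⟩⟩)
  refine ⟨δ, hδ, fun p hp q hq hpq => ?_⟩
  obtain ⟨i, hi⟩ := H p hp
  exact hU i p ⟨hp, hi (Metric.mem_ball_self hδ)⟩ q ⟨hq, hi hpq⟩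

/-- Only points with `f x = lam` need `hlev`. Where `f x > lam`, nearby interior points satisfy the
same inequality by continuity. -/
lemma levelSet_subset_closure (hM : IsC2Submanifold m M) (hf : ContinuousOn f M) {lam : ℝ}
    (hlev : ∀ x ∈ M, f x = lam → ∃ a : ℕ → EuclideanSpace ℝ (Fin d),
      (∀ j, a j ∈ manifoldInterior m M) ∧ Tendsto a atTop (𝓝 x) ∧ ∀ j, lam < f (a j)) :
    levelSet M f lam ⊆ closure (manifoldInterior m M ∩ {x | lam < f x}) := by
  rintro x ⟨hx, hxl⟩
  rcases hxl.eq_or_lt with h | h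
  · obtain ⟨a, ha, hlim, hfa⟩ := hlev x hx h.symm
    exact mem_closure_of_tendsto hlim (Eventually.of_forall fun j => ⟨ha j, hfa j⟩)
  · obtain ⟨Φ, hΦ⟩ := hM.exists_chart x hx
    have hcl := hΦ.mem_closure_manifoldInterior hx hM.dim_le
    have hev : ∀ᶠ y in 𝓝 x, y ∈ M → lam < f y :=
      eventually_nhdsWithin_iff.1 ((hf x hx).eventually (lt_mem_nhds h))
    rw [mem_closure_iff_frequently] at hcl ⊢
    exact (hcl.and_eventually hev).mono fun y hy => ⟨hy.1, hy.2 hy.1.1⟩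

/-- Deterministic criterion: one-sided uniform control from above and eventual membership of a
countable dense set of points give convergence of the level sets. -/
lemma tendsto_hausdorffDist_levelSet (hM : IsC2Submanifold m M) (hMc : IsCompact M)
    (hf : ContinuousOn f M) {lam : ℝ} {g : ℕ → EuclideanSpace ℝ (Fin d) → ℝ}
    {D : Set (EuclideanSpace ℝ (Fin d))} (hDM : D ⊆ M) (hD : levelSet M f lam ⊆ closure D)
    (hlow : ∀ s ∈ D, ∀ᶠ n in atTop, lam ≤ g n s)
    (hupp : ∀ ε > 0, ∀ᶠ n in atTop, ∀ x ∈ M, f x ≤ lam - ε → g n x < lam) :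
    Tendsto (fun n => hausdorffDist M (levelSet M (g n) lam) (levelSet M f lam))
      atTop (𝓝 0) := by
  have hLclosed : IsClosed (levelSet M f lam) :=
    hf.preimage_isClosed_of_isClosed hMc.isClosed isClosed_Ici
  have hLc : IsCompact (levelSet M f lam) := hMc.of_isClosed_subset hLclosed fun x hx => hx.1
  rw [ENNReal.tendsto_nhds_zero]
  intro ε hε
  obtain ⟨ε', hε'0, hε'⟩ : ∃ ε' : ℝ, 0 < ε' ∧ ENNReal.ofReal ε' ≤ ε := by
    rcases eq_or_ne ε ∞ with rfl | h
    · exact ⟨1, one_pos, le_top⟩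
    · exact ⟨ε.toReal, ENNReal.toReal_pos hε.ne' h, ENNReal.ofReal_toReal_le⟩
  obtain ⟨δ, hδ, hgeo⟩ := exists_geodesicDist_le hM hMc hε'0
  -- The maximum of `f` over the compact set `K` of far points is below `lam`: a maximizer with
  -- value at least `lam` would lie in the level set, at distance `0` from itself.
  have hfar : ∃ ε₁ > 0, ∀ x ∈ M, (∀ c ∈ levelSet M f lam, δ ≤ dist c x) → f x ≤ lam - ε₁ := by
    set K := {x | x ∈ M ∧ ∀ c ∈ levelSet M f lam, δ ≤ dist c x}
    have hKc : IsCompact K := by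
      refine hMc.of_isClosed_subset ?_ fun x hx => hx.1
      have : K = M ∩ ⋂ c ∈ levelSet M f lam, {x | δ ≤ dist c x} := by
        ext x; simp [K]
      rw [this]
      exact hMc.isClosed.inter (isClosed_biInter fun c _ =>
        isClosed_le continuous_const (by fun_prop))
    rcases K.eq_empty_or_nonempty with h0 | hne
    · exact ⟨1, one_pos, fun x hx hx' => absurd (show x ∈ K from ⟨hx, hx'⟩) (by simp [h0])⟩
    · obtain ⟨x₀, hx₀, hmax⟩ := hKc.exists_isMaxOn hne (hf.mono fun x hx => hx.1)
      refine ⟨lam - f x₀, ?_, fun x hx hx' => ?_⟩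
      · by_contra hcon
        have := hx₀.2 x₀ ⟨hx₀.1, by linarith⟩
        rw [dist_self] at this
        linarith
      · have : f x ≤ f x₀ := hmax (show x ∈ K from ⟨hx, hx'⟩)
        linarith
  obtain ⟨ε₁, hε₁, hfar⟩ := hfar
  obtain ⟨t, htD, hcov⟩ := hLc.elim_finite_subcover_image (b := D)
    (c := fun s => Metric.ball s δ) (fun _ _ => Metric.isOpen_ball) fun x hx => by
      obtain ⟨s, hs, hxs⟩ := Metric.mem_closure_iff.1 (hD hx) δ hδ
      exact mem_iUnion₂.2 ⟨s, hs, hxs⟩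
  have hall : ∀ᶠ n in atTop, ∀ s ∈ t, lam ≤ g n s :=
    (eventually_all_finite hcov.1).2 fun s hs => hlow s (htD hs)
  filter_upwards [hupp ε₁ hε₁, hall] with n hn1 hn2
  refine sup_le (iSup₂_le fun a ha => ?_) (iSup₂_le fun c hc => ?_)
  · have : ∃ c ∈ levelSet M f lam, dist c a < δ := by
      by_contra! hcon
      exact (hn1 a ha.1 (hfar a ha.1 hcon)).not_ge ha.2
    obtain ⟨c, hc, hca⟩ := this
    exact (iInf₂_le c hc).trans ((hgeo a ha.1 c hc.1 hca).trans hε')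
  · obtain ⟨s, hs, hcs⟩ := mem_iUnion₂.1 (hcov.2 hc)
    refine (iInf₂_le s ⟨hDM (htD hs), hn2 s hs⟩).trans ((hgeo c hc.1 s (hDM (htD hs)) ?_).trans hε')
    rwa [dist_comm]

end Global

/-! ### Almost isometric coordinates in `ℝ^m`. -/

/-- The first `m` coordinates of a vector of `ℝ^d`. -/
noncomputable def firstCoords {d m : ℕ} (hm : m ≤ d) :
    EuclideanSpace ℝ (Fin d) →L[ℝ] EuclideanSpace ℝ (Fin m) :=
  LinearMap.toContinuousLinearMap
    { toFun := fun v => WithLp.toLp 2 fun j => v (Fin.castLE hm j)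
      map_add' := fun v w => by ext; simp
      map_smul' := fun c v => by ext; simp }

/-- The inclusion of `ℝ^m` as the first `m` coordinates of `ℝ^d`. -/
noncomputable def padZero (d m : ℕ) :
    EuclideanSpace ℝ (Fin m) →L[ℝ] EuclideanSpace ℝ (Fin d) :=
  LinearMap.toContinuousLinearMap
    { toFun := fun v => WithLp.toLp 2 fun i => if h : i.val < m then v ⟨i, h⟩ else 0
      map_add' := fun v w => by ext i; by_cases h : i.val < m <;> simp [h]
      map_smul' := fun c v => by ext i; by_cases h : i.val < m <;> simp [h] }

lemma firstCoords_apply {d m : ℕ} (hm : m ≤ d) (v : EuclideanSpace ℝ (Fin d)) (j : Fin m) :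
    firstCoords hm v j = v (Fin.castLE hm j) := rfl

lemma padZero_apply {d m : ℕ} (v : EuclideanSpace ℝ (Fin m)) (i : Fin d) :
    padZero d m v i = if h : i.val < m then v ⟨i, h⟩ else 0 := rfl

lemma firstCoords_padZero {d m : ℕ} (hm : m ≤ d) (v : EuclideanSpace ℝ (Fin m)) :
    firstCoords hm (padZero d m v) = v := by
  ext j
  simp [firstCoords_apply, padZero_apply]

lemma padZero_firstCoords {d m : ℕ} (hm : m ≤ d) {v : EuclideanSpace ℝ (Fin d)}
    (hv : v ∈ halfModel d m) : padZero d m (firstCoords hm v) = v := by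
  ext i
  rw [padZero_apply]
  split_ifs with h
  · rfl
  · exact (hv.1 i (not_lt.1 h)).symm

section Chart

variable {d m : ℕ} {M : Set (EuclideanSpace ℝ (Fin d))} {x : EuclideanSpace ℝ (Fin d)}
  {Φ : OpenPartialHomeomorph (EuclideanSpace ℝ (Fin d)) (EuclideanSpace ℝ (Fin d))}

/-- By the chain rule for `Φ ∘ Φ.symm = id`, the derivative of `Φ` is a left inverse. -/
lemma IsAdaptedChart.injective_fderiv_symm (hΦ : IsAdaptedChart m M x Φ) :
    Function.Injective (fderiv ℝ Φ.symm (Φ x)) := by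
  have h1 : HasFDerivAt Φ.symm (fderiv ℝ Φ.symm (Φ x)) (Φ x) :=
    ((hΦ.contDiffAt_symm hΦ.apply_mem_target).differentiableAt (by norm_num)).hasFDerivAt
  have h2 : HasFDerivAt Φ (fderiv ℝ Φ x) (Φ.symm (Φ x)) := by
    rw [Φ.left_inv hΦ.mem_source]
    exact (hΦ.contDiffAt.differentiableAt (by norm_num)).hasFDerivAt
  have h3 : HasFDerivAt (Φ ∘ Φ.symm) (ContinuousLinearMap.id ℝ _) (Φ x) := by
    refine (hasFDerivAt_id _).congr_of_eventuallyEq ?_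
    filter_upwards [Φ.open_target.mem_nhds hΦ.apply_mem_target] with u hu
    exact Φ.right_inv hu
  have h4 := (h2.comp (Φ x) h1).unique h3
  intro u v huv
  have hu := DFunLike.congr_fun h4 u
  have hv := DFunLike.congr_fun h4 v
  simp only [ContinuousLinearMap.comp_apply, ContinuousLinearMap.id_apply] at hu hv
  rw [← hu, ← hv, huv]

/-- A linear map with injective values has the same norms as some linear automorphism. -/
lemma exists_linearEquiv_norm_eq {E F : Type*} [NormedAddCommGroup E] [InnerProductSpace ℝ E]
    [FiniteDimensional ℝ E] [NormedAddCommGroup F] [InnerProductSpace ℝ F]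
    (A : E →ₗ[ℝ] F) (hA : Function.Injective A) : ∃ B : E ≃ₗ[ℝ] E, ∀ u, ‖B u‖ = ‖A u‖ := by
  have hfin : Module.finrank ℝ (LinearMap.range A) = Module.finrank ℝ E :=
    LinearMap.finrank_range_of_inj hA
  let J : LinearMap.range A ≃ₗᵢ[ℝ] E := (stdOrthonormalBasis ℝ _).equiv (stdOrthonormalBasis ℝ _) (finCongr hfin)
  refine ⟨(LinearEquiv.ofInjective A hA).trans J.toLinearEquiv, fun u => ?_⟩
  simp [J]

/-- Near a point of `M`, the manifold is almost isometric to a subset of `ℝ^m`; near an interior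
point this subset is a neighbourhood. -/
lemma IsAdaptedChart.exists_almost_isometry (hΦ : IsAdaptedChart m M x Φ)
    (hm : m ≤ d) {η : ℝ} (hη0 : 0 < η) (hη1 : η ≤ 1) {N : Set (EuclideanSpace ℝ (Fin d))}
    (hN : N ∈ 𝓝 x) :
    ∃ (G : EuclideanSpace ℝ (Fin d) → EuclideanSpace ℝ (Fin m))
      (U : Set (EuclideanSpace ℝ (Fin d))), IsOpen U ∧ x ∈ U ∧ U ⊆ N ∧
      (∀ p ∈ M ∩ U, ∀ q ∈ M ∩ U, dist p q ≤ (1 + η) * dist (G p) (G q) ∧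
        dist (G p) (G q) ≤ (1 + η) * dist p q) ∧
      (Φ x ∈ halfModelInterior d m → G '' (M ∩ U) ∈ 𝓝 (G x)) := by
  set u₀ := Φ x
  have hu₀ : u₀ ∈ Φ.target := hΦ.apply_mem_target
  set D := fderiv ℝ Φ.symm u₀
  have hDs : HasStrictFDerivAt Φ.symm D u₀ :=
    (hΦ.contDiffAt_symm hu₀).hasStrictFDerivAt (by norm_num)
  have hιinj : Function.Injective (padZero d m) :=
    Function.LeftInverse.injective (firstCoords_padZero hm)
  set A : EuclideanSpace ℝ (Fin m) →ₗ[ℝ] EuclideanSpace ℝ (Fin d) :=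
    (D.comp (padZero d m)).toLinearMap
  have hA : Function.Injective A := hΦ.injective_fderiv_symm.comp hιinj
  have hAapp : ∀ w, A w = D (padZero d m w) := fun w => rfl
  -- `B` corrects the chart linearly so that lengths in `ℝ^m` agree to first order with those on
  -- `M`.
  obtain ⟨B, hB⟩ := exists_linearEquiv_norm_eq A hA
  obtain ⟨c, hc0, hc⟩ : ∃ c : ℝ, 0 < c ∧ ∀ w, ‖padZero d m w‖ ≤ c * ‖B w‖ := by
    refine ⟨‖(padZero d m).comp (LinearMap.toContinuousLinearMap B.symm.toLinearMap)‖ + 1,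
      by positivity, fun w => ?_⟩
    have := ((padZero d m).comp (LinearMap.toContinuousLinearMap B.symm.toLinearMap)).le_opNorm
      (B w)
    simp only [ContinuousLinearMap.comp_apply, LinearMap.coe_toContinuousLinearMap',
      LinearEquiv.coe_coe, LinearEquiv.symm_apply_apply] at this
    nlinarith [norm_nonneg (B w)]
  -- Strict differentiability compares two arbitrary nearby points. The constant `η / (2 * c)` makes
  -- the error at most `η / 2 * ‖B w‖`.
  have hstrict := (hasStrictFDerivAt_iff_isLittleO.1 hDs).bound
    (show (0 : ℝ) < η / (2 * c) by positivity)
  rw [nhds_prod_eq] at hstrict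
  obtain ⟨T, hT, hTb⟩ := mem_prod_self_iff.1 hstrict
  have hnhd : ∀ᶠ y in 𝓝 x, y ∈ N ∧ y ∈ Φ.source ∧ Φ y ∈ T :=
    (show ∀ᶠ y in 𝓝 x, y ∈ N from hN).and
      ((Φ.open_source.eventually_mem hΦ.mem_source).and (hΦ.continuousAt hT))
  obtain ⟨U, hU, hUo, hxU⟩ := eventually_nhds_iff.1 hnhd
  refine ⟨fun p => B (firstCoords hm (Φ p)), U, hUo, hxU, fun y hy => (hU y hy).1, ?_, ?_⟩
  · rintro p ⟨hpM, hpU⟩ q ⟨hqM, hqU⟩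
    obtain ⟨-, hps, hpT⟩ := hU p hpU
    obtain ⟨-, hqs, hqT⟩ := hU q hqU
    have hb := hTb (mk_mem_prod hpT hqT)
    simp only [mem_ofPred_eq, Φ.left_inv hps, Φ.left_inv hqs] at hb
    set w := firstCoords hm (Φ p) - firstCoords hm (Φ q)
    have hw : padZero d m w = Φ p - Φ q := by
      rw [map_sub, padZero_firstCoords hm ((hΦ.mem_iff p hps).2 hpM),
        padZero_firstCoords hm ((hΦ.mem_iff q hqs).2 hqM)]
    have hBw : dist (B (firstCoords hm (Φ p))) (B (firstCoords hm (Φ q))) = ‖B w‖ := by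
      rw [dist_eq_norm, ← map_sub]
    rw [← hw, ← hAapp] at hb
    have hb' : ‖p - q - A w‖ ≤ η / 2 * ‖B w‖ := by
      calc _ ≤ η / (2 * c) * ‖padZero d m w‖ := hb
        _ ≤ η / (2 * c) * (c * ‖B w‖) := by gcongr; exact hc w
        _ = η / 2 * ‖B w‖ := by field_simp
    have h1 : ‖p - q‖ ≤ ‖B w‖ + η / 2 * ‖B w‖ := by
      have := norm_add_le (p - q - A w) (A w)
      rw [sub_add_cancel, ← hB] at this
      linarith
    have h2 : ‖B w‖ ≤ ‖p - q‖ + η / 2 * ‖B w‖ := by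
      have := norm_sub_le (p - q) (p - q - A w)
      rw [sub_sub_cancel, ← hB] at this
      linarith
    rw [hBw, dist_eq_norm]
    have h0 := norm_nonneg (B w)
    constructor
    · nlinarith
    · have h3 : ‖B w‖ * (1 - η / 2) ≤ ‖p - q‖ := by linarith
      have h4 : (1 + η) * (‖B w‖ * (1 - η / 2)) ≤ (1 + η) * ‖p - q‖ := by gcongr
      -- This is `(1 + η) * (1 - η / 2) ≥ 1`, which needs `η ≤ 1`.
      have h5 : 0 ≤ ‖B w‖ * (η * (1 - η)) := mul_nonneg h0 (mul_nonneg hη0.le (by linarith))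
      linarith
  · intro hint
    have hpad : padZero d m (firstCoords hm u₀) = u₀ := padZero_firstCoords hm hint.1
    set S : EuclideanSpace ℝ (Fin m) → EuclideanSpace ℝ (Fin d) :=
      fun z => padZero d m (B.symm z)
    have hScont : Continuous S :=
      (padZero d m).continuous.comp (LinearMap.continuous_of_finiteDimensional B.symm.toLinearMap)
    have hS0 : S (B (firstCoords hm u₀)) = u₀ := by simp [S, hpad]
    have hSt : Tendsto S (𝓝 (B (firstCoords hm u₀))) (𝓝 u₀) := by
      simpa [hS0] using hScont.tendsto (B (firstCoords hm u₀))
    have e1 : ∀ᶠ u in 𝓝 u₀, ∀ i : Fin d, i.val = 0 → i.val < m → 0 < u i := by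
      refine eventually_all.2 fun i => ?_
      by_cases hi : i.val = 0 ∧ i.val < m
      · have hcont : Continuous fun u : EuclideanSpace ℝ (Fin d) => u i := by fun_prop
        filter_upwards [hcont.continuousAt.eventually (lt_mem_nhds (hint.2 i hi.1 hi.2))] with
          u hu _ _ using hu
      · exact Eventually.of_forall fun u h1 h2 => absurd ⟨h1, h2⟩ hi
    have e2 : ∀ᶠ u in 𝓝 u₀, Φ.symm u ∈ U := by
      refine (hΦ.continuousAt_symm hu₀).eventually ?_
      rw [Φ.left_inv hΦ.mem_source]
      exact hUo.mem_nhds hxU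
    filter_upwards [hSt.eventually e1, hSt.eventually e2,
      hSt.eventually (Φ.open_target.mem_nhds hu₀)] with z hz1 hz2 hz3
    have hzm : S z ∈ halfModel d m := by
      refine ⟨fun i hi => by simp [S, padZero_apply, hi.not_gt], fun i hi => ?_⟩
      -- If `m = 0`, coordinate `0` is among the padded zeros and no positivity is available.
      by_cases him : i.val < m
      · exact (hz1 i hi him).le
      · simp [S, padZero_apply, him]
    refine ⟨Φ.symm (S z), ⟨(hΦ.symm_mem_iff hz3).2 hzm, hz2⟩, ?_⟩
    simp only [Φ.right_inv hz3, S, firstCoords_padZero, LinearEquiv.apply_symm_apply]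

end Chart

/-! ### Hausdorff measure against Lebesgue measure under almost isometries. -/

lemma euclideanHausdorffMeasure_image_le {X Y : Type*} [MetricSpace X] [MeasurableSpace X]
    [BorelSpace X] [MetricSpace Y] [MeasurableSpace Y] [BorelSpace Y] {K : NNReal} {g : X → Y}
    {s : Set X} (hg : LipschitzOnWith K g s) (m : ℕ) :
    μHE[m] (g '' s) ≤ (K : ℝ≥0∞) ^ m * μHE[m] s := by
  simp only [Measure.euclideanHausdorffMeasure_def, Measure.smul_apply, ENNReal.smul_def,
    smul_eq_mul]
  rw [mul_left_comm]
  gcongr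
  simpa using hg.hausdorffMeasure_image_le (Nat.cast_nonneg m)

section AlmostIsometry

variable {d m : ℕ} {S : Set (EuclideanSpace ℝ (Fin d))} {K : NNReal}
  {G : EuclideanSpace ℝ (Fin d) → EuclideanSpace ℝ (Fin m)}

/-- The bound `hK` makes `G` injective on `S` with a `K`-Lipschitz inverse, which enlarges
`m`-dimensional measure by at most `K ^ m`. -/
lemma map_restrict_le_smul_volume (hS : MeasurableSet S)
    (hG : ContinuousOn G S)
    (hK : ∀ p ∈ S, ∀ q ∈ S, dist p q ≤ K * dist (G p) (G q)) :
    (μHE[m].restrict S).map G ≤ ((K : ℝ≥0∞) ^ m) • volume := by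
  refine Measure.le_iff.2 fun T hT => ?_
  rw [Measure.map_apply_of_aemeasurable (hG.aemeasurable hS) hT,
    Measure.restrict_apply' hS, Measure.smul_apply, smul_eq_mul]
  rcases S.eq_empty_or_nonempty with rfl | ⟨p₀, hp₀⟩
  · simp
  have : Nonempty (EuclideanSpace ℝ (Fin d)) := ⟨p₀⟩
  have hinj : InjOn G S := fun p hp q hq h => by
    have := hK p hp q hq
    rw [h, dist_self, mul_zero] at this
    exact dist_le_zero.1 this
  have hinv : ∀ p ∈ S, Function.invFunOn G S (G p) = p := fun p hp => hinj.leftInvOn_invFunOn hp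
  have hlip : LipschitzOnWith K (Function.invFunOn G S) (G '' S) := by
    refine LipschitzOnWith.of_dist_le_mul ?_
    rintro _ ⟨p, hp, rfl⟩ _ ⟨q, hq, rfl⟩
    rw [hinv p hp, hinv q hq]
    exact hK p hp q hq
  have hsub : G ⁻¹' T ∩ S ⊆ Function.invFunOn G S '' (T ∩ G '' S) := fun p hp =>
    ⟨G p, ⟨hp.1, p, hp.2, rfl⟩, hinv p hp.2⟩
  calc _ ≤ μHE[m] (Function.invFunOn G S '' (T ∩ G '' S)) := measure_mono hsub
    _ ≤ (K : ℝ≥0∞) ^ m * μHE[m] (T ∩ G '' S) :=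
        euclideanHausdorffMeasure_image_le (hlip.mono inter_subset_right) m
    _ ≤ (K : ℝ≥0∞) ^ m * volume T := by
        rw [EuclideanSpace.euclideanHausdorffMeasure_eq_volume]
        gcongr
        exact inter_subset_left

lemma volume_restrict_image_le (hS : MeasurableSet S)
    (hK : ∀ p ∈ S, ∀ q ∈ S, dist (G p) (G q) ≤ K * dist p q) :
    volume.restrict (G '' S) ≤ ((K : ℝ≥0∞) ^ m) • (μHE[m].restrict S).map G := by
  have hlip : LipschitzOnWith K G S := LipschitzOnWith.of_dist_le_mul hK
  refine Measure.le_iff.2 fun T hT => ?_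
  rw [Measure.smul_apply, smul_eq_mul,
    Measure.map_apply_of_aemeasurable (hlip.continuousOn.aemeasurable hS) hT,
    Measure.restrict_apply' hS, Measure.restrict_apply hT, ← image_preimage_inter]
  rw [← EuclideanSpace.euclideanHausdorffMeasure_eq_volume]
  exact euclideanHausdorffMeasure_image_le (hlip.mono inter_subset_right) m

end AlmostIsometry

/-! ### The scaled Gaussian kernel. -/

/-- The kernel `t ↦ h^(-m) K(t / h)`. -/
noncomputable def scaledKernel (m : ℕ) (h t : ℝ) : ℝ := 1 / h ^ m * gaussKernel m (t / h)

lemma gaussKernel_nonneg (m : ℕ) (t : ℝ) : 0 ≤ gaussKernel m t := by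
  unfold gaussKernel; positivity

lemma gaussKernel_le_one (m : ℕ) (t : ℝ) : gaussKernel m t ≤ 1 := by
  unfold gaussKernel
  have h1 : Real.pi ^ (-(m : ℝ) / 2) ≤ 1 :=
    Real.rpow_le_one_of_one_le_of_nonpos (by linarith [Real.pi_gt_three])
      (by have : (0 : ℝ) ≤ m := Nat.cast_nonneg m
          linarith)
  have h2 : Real.exp (-t ^ 2) ≤ 1 := Real.exp_le_one_iff.2 (by nlinarith [sq_nonneg t])
  exact mul_le_one₀ h1 (Real.exp_pos _).le h2

lemma continuous_gaussKernel (m : ℕ) : Continuous (gaussKernel m) := by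
  unfold gaussKernel; fun_prop

lemma gaussKernel_anti (m : ℕ) {s t : ℝ} (hs : 0 ≤ s) (hst : s ≤ t) :
    gaussKernel m t ≤ gaussKernel m s := by
  unfold gaussKernel
  gcongr

section ScaledKernel

variable {m : ℕ} {h : ℝ}

lemma scaledKernel_nonneg (hh : 0 < h) (t : ℝ) : 0 ≤ scaledKernel m h t :=
  mul_nonneg (by positivity) (gaussKernel_nonneg _ _)

lemma continuous_scaledKernel : Continuous (scaledKernel m h) :=
  continuous_const.mul ((continuous_gaussKernel m).comp (by fun_prop))

lemma scaledKernel_le (hh : 0 < h) (t : ℝ) : scaledKernel m h t ≤ 1 / h ^ m :=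
  mul_le_of_le_one_right (by positivity) (gaussKernel_le_one _ _)

lemma scaledKernel_anti (hh : 0 < h) {s t : ℝ} (hs : 0 ≤ s) (hst : s ≤ t) :
    scaledKernel m h t ≤ scaledKernel m h s := by
  unfold scaledKernel
  gcongr
  exact gaussKernel_anti m (by positivity) (by gcongr)

/-- Converts a distortion of distances into a change of bandwidth, which leaves the total mass equal
to `1`, and a factor `c ^ m`. -/
lemma scaledKernel_mul {c : ℝ} (hc : 0 < c) (t : ℝ) :
    scaledKernel m h (c * t) = (c ^ m)⁻¹ * scaledKernel m (h / c) t := by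
  unfold scaledKernel
  rw [show t / (h / c) = c * t / h by field_simp, div_pow]
  field_simp

lemma scaledKernel_eq (hh : 0 < h) (t : ℝ) :
    scaledKernel m h t = (1 / h ^ m * Real.pi ^ (-(m : ℝ) / 2)) *
      Real.exp (-(1 / h ^ 2) * t ^ 2) := by
  unfold scaledKernel gaussKernel
  rw [mul_assoc]
  congr 3
  field_simp

lemma integrable_scaledKernel (hh : 0 < h) :
    Integrable fun z : EuclideanSpace ℝ (Fin m) => scaledKernel m h ‖z‖ := by
  simp_rw [scaledKernel_eq hh]
  refine Integrable.const_mul ?_ _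
  have := GaussianFourier.integrable_cexp_neg_mul_sq_norm_add
    (V := EuclideanSpace ℝ (Fin m)) (b := ((1 / h ^ 2 : ℝ) : ℂ)) (by
      rw [Complex.ofReal_re]; positivity) 0 0
  refine this.re.congr (Eventually.of_forall fun z => ?_)
  simp only [zero_mul, add_zero]
  norm_cast

lemma integral_scaledKernel (hh : 0 < h) :
    ∫ z : EuclideanSpace ℝ (Fin m), scaledKernel m h ‖z‖ = 1 := by
  simp_rw [scaledKernel_eq hh]
  rw [integral_const_mul, GaussianFourier.integral_rexp_neg_mul_sq_norm (by positivity),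
    finrank_euclideanSpace_fin, div_div_eq_mul_div, div_one,
    Real.mul_rpow Real.pi_pos.le (by positivity), ← Real.rpow_natCast h 2, ← Real.rpow_mul hh.le,
    ← Real.rpow_natCast h m, neg_div, Real.rpow_neg Real.pi_pos.le]
  have h1 : Real.pi ^ ((m : ℝ) / 2) ≠ 0 := (Real.rpow_pos_of_pos Real.pi_pos _).ne'
  have h2 : h ^ (m : ℝ) ≠ 0 := (Real.rpow_pos_of_pos hh _).ne'
  rw [show ((2 : ℕ) : ℝ) * (m / 2) = m by push_cast; ring]
  field_simp

lemma lintegral_scaledKernel (hh : 0 < h) (a : EuclideanSpace ℝ (Fin m)) :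
    ∫⁻ z, ENNReal.ofReal (scaledKernel m h (dist a z)) = 1 := by
  simp_rw [dist_comm a, dist_eq_norm]
  rw [lintegral_sub_right_eq_self (fun z => ENNReal.ofReal (scaledKernel m h ‖z‖)) a,
    ← ofReal_integral_eq_lintegral_ofReal (integrable_scaledKernel hh)
      (Eventually.of_forall fun z => scaledKernel_nonneg hh _), integral_scaledKernel hh,
    ENNReal.ofReal_one]

/-- Half of the exponent `t² / h²` yields the small factor; the other half is a kernel of bandwidth
`√2 * h`, with `√2 ^ m` correcting its normalization. -/
lemma scaledKernel_le_of_le (hh : 0 < h) {r t : ℝ} (hr : 0 ≤ r) (hrt : r ≤ t) :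
    scaledKernel m h t ≤
      √2 ^ m * Real.exp (-(r ^ 2 / (2 * h ^ 2))) * scaledKernel m (√2 * h) t := by
  have h2 : (0 : ℝ) < √2 := by positivity
  rw [scaledKernel_eq hh, scaledKernel_eq (by positivity), mul_pow, mul_pow,
    Real.sq_sqrt (by norm_num)]
  have hexp : Real.exp (-(1 / h ^ 2) * t ^ 2) ≤
      Real.exp (-(r ^ 2 / (2 * h ^ 2))) * Real.exp (-(1 / (2 * h ^ 2)) * t ^ 2) := by
    rw [← Real.exp_add, Real.exp_le_exp]
    have h3 : r ^ 2 ≤ t ^ 2 := by gcongr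
    have h4 : -(1 / h ^ 2) * t ^ 2 = -(t ^ 2 / (2 * h ^ 2)) + -(1 / (2 * h ^ 2)) * t ^ 2 := by
      field_simp; ring
    rw [h4]
    gcongr
  calc _ ≤ (1 / h ^ m * Real.pi ^ (-(m : ℝ) / 2)) *
        (Real.exp (-(r ^ 2 / (2 * h ^ 2))) * Real.exp (-(1 / (2 * h ^ 2)) * t ^ 2)) := by gcongr
    _ = _ := by field_simp

/-- Almost all the mass of the scaled kernel is in a fixed ball. -/
lemma one_le_lintegral_ball_scaledKernel (hh : 0 < h) {r : ℝ} (hr : 0 ≤ r)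
    (a : EuclideanSpace ℝ (Fin m)) :
    1 ≤ (∫⁻ z in Metric.ball a r, ENNReal.ofReal (scaledKernel m h (dist a z))) +
      ENNReal.ofReal (√2 ^ m * Real.exp (-(r ^ 2 / (2 * h ^ 2)))) := by
  rw [← lintegral_scaledKernel hh a, ← lintegral_add_compl _ (Metric.isOpen_ball (x := a)
    (ε := r)).measurableSet]
  gcongr
  calc _ ≤ ∫⁻ z in (Metric.ball a r)ᶜ,
        ENNReal.ofReal (√2 ^ m * Real.exp (-(r ^ 2 / (2 * h ^ 2)))) *
          ENNReal.ofReal (scaledKernel m (√2 * h) (dist a z)) := by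
        refine setLIntegral_mono' Metric.isOpen_ball.measurableSet.compl fun z hz => ?_
        rw [← ENNReal.ofReal_mul (by positivity)]
        refine ENNReal.ofReal_le_ofReal (scaledKernel_le_of_le hh hr ?_)
        rw [dist_comm]
        simpa using hz
    _ ≤ ∫⁻ z, ENNReal.ofReal (√2 ^ m * Real.exp (-(r ^ 2 / (2 * h ^ 2)))) *
          ENNReal.ofReal (scaledKernel m (√2 * h) (dist a z)) := setLIntegral_le_lintegral _ _
    _ = _ := by
        rw [lintegral_const_mul' _ _ ENNReal.ofReal_ne_top,
          lintegral_scaledKernel (by positivity), mul_one]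

end ScaledKernel

lemma tendsto_exp_neg_div_sq {c : ℝ} (hc : 0 < c) :
    Tendsto (fun h : ℝ => Real.exp (-(c / h ^ 2))) (𝓝[>] 0) (𝓝 0) := by
  refine Real.tendsto_exp_neg_atTop_nhds_zero.comp ?_
  have h1 : Tendsto (fun h : ℝ => h ^ 2) (𝓝[>] 0) (𝓝[>] 0) := by
    refine tendsto_nhdsWithin_iff.2 ⟨?_, ?_⟩
    · have : Continuous fun h : ℝ => h ^ 2 := by fun_prop
      simpa using (this.tendsto 0).mono_left nhdsWithin_le_nhds
    · filter_upwards [self_mem_nhdsWithin] with h hh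
      exact pow_pos (show (0 : ℝ) < h from hh) 2
  simpa [div_eq_mul_inv] using (tendsto_inv_nhdsGT_zero.comp h1).const_mul_atTop hc

/-- With `u = r / h` the value is a constant times `u^m * exp (-u²)`, and `exp (-u²) ≤ exp (-u)`
once `u ≥ 1`. -/
lemma tendsto_scaledKernel_zero (m : ℕ) {r : ℝ} (hr : 0 < r) :
    Tendsto (fun h => scaledKernel m h r) (𝓝[>] 0) (𝓝 0) := by
  have h1 := (Real.tendsto_pow_mul_exp_neg_atTop_nhds_zero m).comp
    ((tendsto_inv_nhdsGT_zero (𝕜 := ℝ)).const_mul_atTop hr)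
  have h2 : Tendsto (fun h : ℝ => Real.pi ^ (-(m : ℝ) / 2) / r ^ m *
      ((r * h⁻¹) ^ m * Real.exp (-(r * h⁻¹)))) (𝓝[>] 0) (𝓝 0) := by
    simpa using h1.const_mul (Real.pi ^ (-(m : ℝ) / 2) / r ^ m)
  refine squeeze_zero' ?_ ?_ h2
  · filter_upwards [self_mem_nhdsWithin] with h hh using scaledKernel_nonneg hh _
  · filter_upwards [Ioo_mem_nhdsGT hr] with h hh
    have hh0 : 0 < h := hh.1
    have h3 : 1 ≤ r * h⁻¹ := by
      rw [← div_eq_mul_inv, one_le_div hh0]; exact hh.2.le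
    unfold scaledKernel gaussKernel
    rw [div_eq_mul_inv r h]
    have h4 : Real.exp (-(r * h⁻¹) ^ 2) ≤ Real.exp (-(r * h⁻¹)) := by
      rw [Real.exp_le_exp]; nlinarith
    calc _ ≤ 1 / h ^ m * (Real.pi ^ (-(m : ℝ) / 2) * Real.exp (-(r * h⁻¹))) := by gcongr
      _ = _ := by rw [mul_pow, inv_pow]; field_simp

/-! ### Asymptotics of the mean. -/

/-- The mean of the kernel density estimator for the law `Q`. -/
noncomputable def kernelMean {d : ℕ} (m : ℕ) (Q : Measure (EuclideanSpace ℝ (Fin d))) (h : ℝ)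
    (x : EuclideanSpace ℝ (Fin d)) : ℝ := ∫ y, scaledKernel m h (dist x y) ∂Q

section Mean

variable {d m : ℕ} {M : Set (EuclideanSpace ℝ (Fin d))} {f : EuclideanSpace ℝ (Fin d) → ℝ}
  {Q : Measure (EuclideanSpace ℝ (Fin d))}

lemma ofReal_kernelMean [IsProbabilityMeasure Q] {h : ℝ} (hh : 0 < h)
    (x : EuclideanSpace ℝ (Fin d)) :
    ENNReal.ofReal (kernelMean m Q h x) = ∫⁻ y, ENNReal.ofReal (scaledKernel m h (dist x y)) ∂Q := by
  refine ofReal_integral_eq_lintegral_ofReal ?_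
    (Eventually.of_forall fun z => scaledKernel_nonneg hh _)
  refine Integrable.of_bound (C := 1 / h ^ m)
    (continuous_scaledKernel.comp (by fun_prop)).aestronglyMeasurable
    (Eventually.of_forall fun y => ?_)
  rw [Real.norm_of_nonneg (scaledKernel_nonneg hh _)]
  exact scaledKernel_le hh _

lemma kernelMean_nonneg {h : ℝ} (hh : 0 < h) (x : EuclideanSpace ℝ (Fin d)) :
    0 ≤ kernelMean m Q h x :=
  integral_nonneg fun _ => scaledKernel_nonneg hh _

lemma setLIntegral_withDensity_volumeOn (hMm : MeasurableSet M) (hf : ContinuousOn f M)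
    (hQ : Q = (volumeOn m M).withDensity fun x => ENNReal.ofReal (f x))
    {U : Set (EuclideanSpace ℝ (Fin d))} (hU : MeasurableSet U)
    {g : EuclideanSpace ℝ (Fin d) → ℝ≥0∞} (hg : Measurable g) :
    ∫⁻ y in U, g y ∂Q = ∫⁻ y in M ∩ U, ENNReal.ofReal (f y) * g y ∂μHE[m] := by
  have hfm : AEMeasurable (fun x => ENNReal.ofReal (f x)) (volumeOn m M) :=
    (hf.aemeasurable hMm).ennreal_ofReal
  rw [hQ, restrict_withDensity hU, lintegral_withDensity_eq_lintegral_mul₀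
    (hfm.mono_measure Measure.restrict_le_self) hg.aemeasurable, volumeOn,
    Measure.restrict_restrict hU, inter_comm]
  rfl

lemma measurable_ofReal_scaledKernel {h : ℝ} (x : EuclideanSpace ℝ (Fin d)) :
    Measurable fun y => ENNReal.ofReal (scaledKernel m h (dist x y)) :=
  ((continuous_scaledKernel (m := m)).comp (by fun_prop)).measurable.ennreal_ofReal

/-- One factor `c ^ m` comes from the kernel, one from the measure. Enlarging `G '' S` to all of
`ℝ^m` is harmless for an upper bound, so boundary points are allowed. -/
lemma lintegral_scaledKernel_le {S : Set (EuclideanSpace ℝ (Fin d))}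
    {G : EuclideanSpace ℝ (Fin d) → EuclideanSpace ℝ (Fin m)} {c : ℝ} (hc : 0 < c)
    (hS : MeasurableSet S)
    (hG : ∀ p ∈ S, ∀ q ∈ S, dist p q ≤ c * dist (G p) (G q) ∧ dist (G p) (G q) ≤ c * dist p q)
    {h : ℝ} (hh : 0 < h) {x : EuclideanSpace ℝ (Fin d)} (hx : x ∈ S) :
    ∫⁻ y in S, ENNReal.ofReal (scaledKernel m h (dist x y)) ∂μHE[m] ≤
      ENNReal.ofReal (c ^ (2 * m)) := by
  have hcont : ContinuousOn G S := (LipschitzOnWith.of_dist_le_mul (K := c.toNNReal)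
    (by simpa [hc.le] using fun p hp q hq => (hG p hp q hq).2)).continuousOn
  have hmap := map_restrict_le_smul_volume (K := c.toNNReal) hS hcont
    (by simpa [hc.le] using fun p hp q hq => (hG p hp q hq).1)
  have hcm : ENNReal.ofReal (c ^ m) = (c.toNNReal : ℝ≥0∞) ^ m := by
    rw [ENNReal.ofReal_pow hc.le]; rfl
  have hmeas : Measurable fun z : EuclideanSpace ℝ (Fin m) =>
      ENNReal.ofReal (scaledKernel m h (c⁻¹ * dist (G x) z)) :=
    ((continuous_scaledKernel (m := m)).comp (by fun_prop)).measurable.ennreal_ofReal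
  calc _ ≤ ∫⁻ y in S, ENNReal.ofReal (scaledKernel m h (c⁻¹ * dist (G x) (G y))) ∂μHE[m] := by
        refine setLIntegral_mono' hS fun y hy => ENNReal.ofReal_le_ofReal ?_
        refine scaledKernel_anti hh (by positivity) ?_
        rw [inv_mul_le_iff₀ hc]
        exact (hG x hx y hy).2
    _ = ∫⁻ z, ENNReal.ofReal (scaledKernel m h (c⁻¹ * dist (G x) z)) ∂(μHE[m].restrict S).map G :=
        (lintegral_map' hmeas.aemeasurable (hcont.aemeasurable hS)).symm
    _ ≤ ∫⁻ z, ENNReal.ofReal (scaledKernel m h (c⁻¹ * dist (G x) z))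
          ∂(((c.toNNReal : ℝ≥0∞) ^ m) • volume) := lintegral_mono' hmap le_rfl
    _ = ENNReal.ofReal (c ^ (2 * m)) := by
        simp_rw [scaledKernel_mul (inv_pos.2 hc)]
        simp_rw [ENNReal.ofReal_mul (show 0 ≤ ((c⁻¹ ^ m)⁻¹ : ℝ) by positivity)]
        rw [lintegral_smul_measure, lintegral_const_mul' _ _ ENNReal.ofReal_ne_top,
          lintegral_scaledKernel (by positivity), mul_one, smul_eq_mul, ← hcm,
          ← ENNReal.ofReal_mul (by positivity)]
        congr 1
        rw [inv_pow, inv_inv, ← pow_add, two_mul]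

/-- The reverse comparison needs a full ball in `G '' S`; the mass outside that ball is the
exponential term. -/
lemma one_le_lintegral_scaledKernel {S : Set (EuclideanSpace ℝ (Fin d))}
    {G : EuclideanSpace ℝ (Fin d) → EuclideanSpace ℝ (Fin m)} {c : ℝ} (hc : 0 < c)
    (hS : MeasurableSet S)
    (hG : ∀ p ∈ S, ∀ q ∈ S, dist p q ≤ c * dist (G p) (G q) ∧ dist (G p) (G q) ≤ c * dist p q)
    {h : ℝ} (hh : 0 < h) {x : EuclideanSpace ℝ (Fin d)} (hx : x ∈ S) {r : ℝ} (hr : 0 ≤ r)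
    (hball : Metric.ball (G x) r ⊆ G '' S) :
    1 ≤ ENNReal.ofReal (c ^ (2 * m)) *
        (∫⁻ y in S, ENNReal.ofReal (scaledKernel m h (dist x y)) ∂μHE[m]) +
      ENNReal.ofReal (√2 ^ m * Real.exp (-(r ^ 2 / (2 * (h / c) ^ 2)))) := by
  have hcont : ContinuousOn G S := (LipschitzOnWith.of_dist_le_mul (K := c.toNNReal)
    (by simpa [hc.le] using fun p hp q hq => (hG p hp q hq).2)).continuousOn
  have hmap := volume_restrict_image_le (K := c.toNNReal) hS
    (by simpa [hc.le] using fun p hp q hq => (hG p hp q hq).2)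
  have hcm : ENNReal.ofReal (c ^ m) = (c.toNNReal : ℝ≥0∞) ^ m := by
    rw [ENNReal.ofReal_pow hc.le]; rfl
  have hmeas : Measurable fun z : EuclideanSpace ℝ (Fin m) =>
      ENNReal.ofReal (scaledKernel m h (c * dist (G x) z)) :=
    ((continuous_scaledKernel (m := m)).comp (by fun_prop)).measurable.ennreal_ofReal
  refine (one_le_lintegral_ball_scaledKernel (show 0 < h / c by positivity) hr (G x)).trans ?_
  gcongr
  calc _ = ENNReal.ofReal (c ^ m) *
        ∫⁻ z in Metric.ball (G x) r, ENNReal.ofReal (scaledKernel m h (c * dist (G x) z)) := by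
        simp_rw [scaledKernel_mul hc, ENNReal.ofReal_mul (show 0 ≤ (c ^ m)⁻¹ by positivity)]
        rw [lintegral_const_mul' _ _ ENNReal.ofReal_ne_top, ← mul_assoc,
          ← ENNReal.ofReal_mul (by positivity), mul_inv_cancel₀ (by positivity),
          ENNReal.ofReal_one, one_mul]
    _ ≤ ENNReal.ofReal (c ^ m) * ∫⁻ z, ENNReal.ofReal (scaledKernel m h (c * dist (G x) z))
          ∂(((c.toNNReal : ℝ≥0∞) ^ m) • (μHE[m].restrict S).map G) := by
        gcongr
        exact (Measure.restrict_mono_set _ hball).trans hmap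
    _ = ENNReal.ofReal (c ^ (2 * m)) *
          ∫⁻ y in S, ENNReal.ofReal (scaledKernel m h (c * dist (G x) (G y))) ∂μHE[m] := by
        rw [lintegral_smul_measure, lintegral_map' hmeas.aemeasurable (hcont.aemeasurable hS),
          smul_eq_mul, ← hcm, ← mul_assoc, ← ENNReal.ofReal_mul (by positivity), ← pow_add,
          two_mul]
    _ ≤ _ := by
        gcongr 1
        refine setLIntegral_mono' hS fun y hy => ENNReal.ofReal_le_ofReal ?_
        exact scaledKernel_anti hh dist_nonneg (hG x hx y hy).1

/-- Local bounds glue by compactness. Near `x₀` the density is almost constant and the kernel mass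
at most `(1 + η) ^ (2 * m)`; far away the kernel itself is at most `η`. -/
lemma eventually_kernelMean_le (hM : IsC2Submanifold m M) (hMc : IsCompact M)
    (hf : ContinuousOn f M) (hf0 : ∀ x ∈ M, 0 ≤ f x) [IsProbabilityMeasure Q]
    (hQ : Q = (volumeOn m M).withDensity fun x => ENNReal.ofReal (f x)) {ε : ℝ} (hε : 0 < ε) :
    ∀ᶠ h in 𝓝[>] 0, ∀ x ∈ M, kernelMean m Q h x ≤ f x + ε := by
  refine hMc.induction_on (p := fun s => ∀ᶠ h in 𝓝[>] 0, ∀ x ∈ s, kernelMean m Q h x ≤ f x + ε)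
    (by simp) (fun s t hst ht => ht.mono fun h H x hx => H x (hst hx))
    (fun s t hs ht => (hs.and ht).mono fun h H x hx => hx.elim (H.1 x) (H.2 x)) ?_
  intro x₀ hx₀
  obtain ⟨η, hη, hη0, hη1⟩ : ∃ η : ℝ, (f x₀ + η) * (1 + η) ^ (2 * m) + η < f x₀ - η + ε ∧
      0 < η ∧ η < 1 := by
    have hc : Tendsto (fun η : ℝ => f x₀ - η + ε - ((f x₀ + η) * (1 + η) ^ (2 * m) + η))
        (𝓝[>] 0) (𝓝 ε) := by
      have : Continuous fun η : ℝ => f x₀ - η + ε - ((f x₀ + η) * (1 + η) ^ (2 * m) + η) := by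
        fun_prop
      simpa using (this.tendsto 0).mono_left nhdsWithin_le_nhds
    obtain ⟨η, h1, h2⟩ := ((hc.eventually (lt_mem_nhds hε)).and
      (Ioo_mem_nhdsGT (show (0 : ℝ) < 1 by norm_num))).exists
    exact ⟨η, by linarith, h2.1, h2.2⟩
  have hN : {y | y ∈ M → f y ∈ Ioo (f x₀ - η) (f x₀ + η)} ∈ 𝓝 x₀ :=
    mem_nhdsWithin_iff_eventually.1 (hf x₀ hx₀ (Ioo_mem_nhds (by linarith) (by linarith)))
  obtain ⟨Φ, hΦ⟩ := hM.exists_chart x₀ hx₀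
  obtain ⟨G, U, hUo, hxU, hUN, hG, -⟩ := hΦ.exists_almost_isometry hM.dim_le hη0 hη1.le hN
  obtain ⟨r, hr, hrU⟩ := Metric.isOpen_iff.1 hUo x₀ hxU
  -- Halving the radius keeps every point outside `U` at distance at least `r / 2` from `x`.
  refine ⟨M ∩ Metric.ball x₀ (r / 2), inter_mem self_mem_nhdsWithin
    (nhdsWithin_le_nhds (Metric.ball_mem_nhds _ (by positivity))), ?_⟩
  filter_upwards [self_mem_nhdsWithin,
    (tendsto_scaledKernel_zero m (half_pos hr)).eventually (gt_mem_nhds hη0)] with h hh hsmall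
  have hh : 0 < h := hh
  rintro x ⟨hxM, hxb⟩
  have hxU' : x ∈ U := hrU (Metric.ball_subset_ball (by linarith) hxb)
  have hfx := hUN hxU' hxM
  have hSm : MeasurableSet (M ∩ U) := hMc.measurableSet.inter hUo.measurableSet
  have hnear : ∫⁻ y in U, ENNReal.ofReal (scaledKernel m h (dist x y)) ∂Q ≤
      ENNReal.ofReal ((f x₀ + η) * (1 + η) ^ (2 * m)) := by
    rw [setLIntegral_withDensity_volumeOn hMc.measurableSet hf hQ hUo.measurableSet
      (measurable_ofReal_scaledKernel x)]
    calc _ ≤ ∫⁻ y in M ∩ U, ENNReal.ofReal (f x₀ + η) *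
          ENNReal.ofReal (scaledKernel m h (dist x y)) ∂μHE[m] := by
          refine setLIntegral_mono' hSm fun y hy => ?_
          gcongr
          exact (hUN hy.2 hy.1).2.le
      _ ≤ _ := by
          rw [lintegral_const_mul' _ _ ENNReal.ofReal_ne_top,
            ENNReal.ofReal_mul (by linarith [hf0 x₀ hx₀])]
          gcongr
          exact lintegral_scaledKernel_le (by positivity) hSm hG hh ⟨hxM, hxU'⟩
  have hfar : ∫⁻ y in Uᶜ, ENNReal.ofReal (scaledKernel m h (dist x y)) ∂Q ≤ ENNReal.ofReal η := by
    calc _ ≤ ∫⁻ _ in Uᶜ, ENNReal.ofReal η ∂Q := by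
          refine setLIntegral_mono' hUo.measurableSet.compl fun y hy => ENNReal.ofReal_le_ofReal ?_
          refine (scaledKernel_anti hh (half_pos hr).le ?_).trans hsmall.le
          by_contra! hcon
          refine hy (hrU ?_)
          rw [Metric.mem_ball] at hxb ⊢
          linarith [dist_triangle_left y x₀ x]
      _ ≤ ∫⁻ _, ENNReal.ofReal η ∂Q := setLIntegral_le_lintegral _ _
      _ = _ := by simp
  have htot : ENNReal.ofReal (kernelMean m Q h x) ≤
      ENNReal.ofReal ((f x₀ + η) * (1 + η) ^ (2 * m) + η) := by
    rw [ofReal_kernelMean hh, ← lintegral_add_compl _ hUo.measurableSet,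
      ENNReal.ofReal_add (mul_nonneg (by linarith [hf0 x₀ hx₀]) (by positivity)) hη0.le]
    exact add_le_add hnear hfar
  have hpos : 0 ≤ (f x₀ + η) * (1 + η) ^ (2 * m) + η :=
    add_nonneg (mul_nonneg (by linarith [hf0 x₀ hx₀]) (by positivity)) hη0.le
  have := (ENNReal.ofReal_le_ofReal_iff hpos).1 htot
  linarith [hfx.1]

lemma eventually_le_kernelMean (hM : IsC2Submanifold m M) (hMc : IsCompact M)
    (hf : ContinuousOn f M) [IsProbabilityMeasure Q]
    (hQ : Q = (volumeOn m M).withDensity fun x => ENNReal.ofReal (f x))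
    {a : EuclideanSpace ℝ (Fin d)} (ha : a ∈ manifoldInterior m M) (hfa : 0 < f a) {b : ℝ}
    (hb : b < f a) : ∀ᶠ h in 𝓝[>] 0, b ≤ kernelMean m Q h a := by
  obtain ⟨haM, Φ, hΦ, hΦa⟩ := ha
  obtain ⟨η, hη, hηa, hη0, hη1⟩ : ∃ η : ℝ, b * (1 + η) ^ (2 * m) < f a - η - η ∧
      η < f a ∧ 0 < η ∧ η < 1 := by
    have hc : Tendsto (fun η : ℝ => f a - η - η - b * (1 + η) ^ (2 * m)) (𝓝[>] 0)
        (𝓝 (f a - b)) := by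
      have : Continuous fun η : ℝ => f a - η - η - b * (1 + η) ^ (2 * m) := by fun_prop
      simpa using (this.tendsto 0).mono_left nhdsWithin_le_nhds
    obtain ⟨η, ⟨h1, h3⟩, h2⟩ := (((hc.eventually (lt_mem_nhds (sub_pos.2 hb))).and
      (Ioo_mem_nhdsGT hfa)).and (Ioo_mem_nhdsGT (show (0 : ℝ) < 1 by norm_num))).exists
    exact ⟨η, by linarith, h3.2, h2.1, h2.2⟩
  have hN : {y | y ∈ M → f a - η < f y} ∈ 𝓝 a :=
    mem_nhdsWithin_iff_eventually.1 (hf a haM (lt_mem_nhds (by linarith)))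
  obtain ⟨G, U, hUo, haU, hUN, hG, hint⟩ := hΦ.exists_almost_isometry hM.dim_le hη0 hη1.le hN
  obtain ⟨r, hr, hball⟩ := Metric.mem_nhds_iff.1 (hint hΦa)
  have hSm : MeasurableSet (M ∩ U) := hMc.measurableSet.inter hUo.measurableSet
  have hsm : Tendsto (fun h : ℝ => (f a - η) *
      (√2 ^ m * Real.exp (-(r ^ 2 / (2 * (h / (1 + η)) ^ 2))))) (𝓝[>] 0) (𝓝 0) := by
    have h1 := (tendsto_exp_neg_div_sq (c := r ^ 2 * (1 + η) ^ 2 / 2) (by positivity)).const_mul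
      ((f a - η) * √2 ^ m)
    rw [mul_zero] at h1
    refine h1.congr fun h => ?_
    rw [mul_assoc]
    congr 4
    field_simp
  filter_upwards [self_mem_nhdsWithin, hsm.eventually (gt_mem_nhds hη0)] with h hh hsmall
  have hh : 0 < h := hh
  have key := one_le_lintegral_scaledKernel (by positivity) hSm hG hh ⟨haM, haU⟩ hr.le hball
  have hlow : ENNReal.ofReal (f a - η) *
      (∫⁻ y in M ∩ U, ENNReal.ofReal (scaledKernel m h (dist a y)) ∂μHE[m]) ≤
      ENNReal.ofReal (kernelMean m Q h a) := by
    calc _ = ∫⁻ y in M ∩ U, ENNReal.ofReal (f a - η) *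
          ENNReal.ofReal (scaledKernel m h (dist a y)) ∂μHE[m] :=
          (lintegral_const_mul' _ _ ENNReal.ofReal_ne_top).symm
      _ ≤ ∫⁻ y in M ∩ U, ENNReal.ofReal (f y) *
          ENNReal.ofReal (scaledKernel m h (dist a y)) ∂μHE[m] := by
          refine setLIntegral_mono' hSm fun y hy => ?_
          gcongr
          exact (hUN hy.2 hy.1).le
      _ = ∫⁻ y in U, ENNReal.ofReal (scaledKernel m h (dist a y)) ∂Q :=
          (setLIntegral_withDensity_volumeOn hMc.measurableSet hf hQ hUo.measurableSet
            (measurable_ofReal_scaledKernel a)).symm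
      _ ≤ _ := by
          rw [ofReal_kernelMean hh]
          exact setLIntegral_le_lintegral _ _
  have htot : ENNReal.ofReal (f a - η) ≤
      ENNReal.ofReal ((1 + η) ^ (2 * m) * kernelMean m Q h a + η) := by
    calc ENNReal.ofReal (f a - η) = ENNReal.ofReal (f a - η) * 1 := (mul_one _).symm
      _ ≤ ENNReal.ofReal (f a - η) * _ := mul_le_mul_right key _
      _ = ENNReal.ofReal ((1 + η) ^ (2 * m)) * (ENNReal.ofReal (f a - η) *
          (∫⁻ y in M ∩ U, ENNReal.ofReal (scaledKernel m h (dist a y)) ∂μHE[m])) +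
          ENNReal.ofReal ((f a - η) *
            (√2 ^ m * Real.exp (-(r ^ 2 / (2 * (h / (1 + η)) ^ 2))))) := by
          rw [ENNReal.ofReal_mul (show 0 ≤ f a - η by linarith)]
          ring
      _ ≤ ENNReal.ofReal ((1 + η) ^ (2 * m)) * ENNReal.ofReal (kernelMean m Q h a) +
          ENNReal.ofReal η := by gcongr
      _ = _ := by
          rw [← ENNReal.ofReal_mul (by positivity), ← ENNReal.ofReal_add
            (mul_nonneg (by positivity) (kernelMean_nonneg hh a)) hη0.le]
  have hfin := (ENNReal.ofReal_le_ofReal_iff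
    (add_nonneg (mul_nonneg (by positivity) (kernelMean_nonneg hh a)) hη0.le)).1 htot
  have hpos : 0 < (1 + η) ^ (2 * m) := by positivity
  refine le_of_mul_le_mul_left ?_ hpos
  linarith

end Mean

/-! ### Chernoff bounds and Borel–Cantelli. -/

section Concentration

variable {Ω : Type*} [MeasurableSpace Ω] {P : Measure Ω} [IsProbabilityMeasure P]

/-- By convexity, `exp (t Y) ≤ 1 + (exp t - 1) Y`. Keeping the mean, here of the form `h ^ m *
kernelMean`, in the exponent leads to rates in `n h^m`; a Hoeffding bound would only give `n
h^(2m)`. -/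
lemma mgf_le_exp_of_mem_Icc {Y : Ω → ℝ} (hYm : Measurable Y) (hY : ∀ ω, Y ω ∈ Icc (0 : ℝ) 1)
    (t : ℝ) : mgf Y P t ≤ Real.exp ((Real.exp t - 1) * ∫ ω, Y ω ∂P) := by
  have hint : Integrable Y P := Integrable.of_bound (C := 1) hYm.aestronglyMeasurable
    (Eventually.of_forall fun ω => by
      rw [Real.norm_of_nonneg (hY ω).1]; exact (hY ω).2)
  calc mgf Y P t ≤ ∫ ω, (1 + (Real.exp t - 1) * Y ω) ∂P := by
        refine integral_mono (integrable_exp_mul_of_mem_Icc hYm.aemeasurable (Eventually.of_forall hY))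
          ((integrable_const _).add (hint.const_mul _)) fun ω => ?_
        have := convexOn_exp.2 (mem_univ 0) (mem_univ t) (sub_nonneg.2 (hY ω).2) (hY ω).1
          (sub_add_cancel _ _)
        simp only [smul_eq_mul, mul_zero, zero_add, Real.exp_zero, mul_one] at this
        rw [mul_comm t]
        linarith
    _ = (Real.exp t - 1) * ∫ ω, Y ω ∂P + 1 := by
        rw [integral_add (integrable_const _) (hint.const_mul _), integral_const_mul]
        simp [add_comm]
    _ ≤ _ := Real.add_one_le_exp _

variable {Y : ℕ → Ω → ℝ}

lemma mgf_sum_le_exp (hYi : iIndepFun Y P) (hYm : ∀ i, Measurable (Y i))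
    (hY : ∀ i ω, Y i ω ∈ Icc (0 : ℝ) 1) {q : ℝ} (hq : ∀ i, ∫ ω, Y i ω ∂P = q) (n : ℕ) (t : ℝ) :
    mgf (∑ i ∈ Finset.range n, Y i) P t ≤ Real.exp (n * ((Real.exp t - 1) * q)) := by
  rw [hYi.mgf_sum hYm, Real.exp_nat_mul]
  calc _ ≤ ∏ _i ∈ Finset.range n, Real.exp ((Real.exp t - 1) * q) :=
        Finset.prod_le_prod (fun i _ => mgf_nonneg) fun i _ => by
          rw [← hq i]; exact mgf_le_exp_of_mem_Icc (hYm i) (hY i) t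
    _ = _ := by simp

lemma integrable_exp_sum (hYm : ∀ i, Measurable (Y i))
    (hY : ∀ i ω, Y i ω ∈ Icc (0 : ℝ) 1) (n : ℕ) (t : ℝ) :
    Integrable (fun ω => Real.exp (t * (∑ i ∈ Finset.range n, Y i) ω)) P := by
  refine integrable_exp_mul_of_mem_Icc (a := 0) (b := n)
    (Finset.aemeasurable_sum _ fun i _ => (hYm i).aemeasurable)
    (Eventually.of_forall fun ω => ?_)
  rw [Finset.sum_apply]
  refine ⟨Finset.sum_nonneg fun i _ => (hY i ω).1, ?_⟩
  simpa using Finset.sum_le_card_nsmul (Finset.range n) (fun i => Y i ω) 1 fun i _ => (hY i ω).2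

lemma measure_sum_ge_le_exp (hYi : iIndepFun Y P) (hYm : ∀ i, Measurable (Y i))
    (hY : ∀ i ω, Y i ω ∈ Icc (0 : ℝ) 1) {q : ℝ} (hq : ∀ i, ∫ ω, Y i ω ∂P = q) (n : ℕ) {t : ℝ}
    (ht : 0 ≤ t) (a : ℝ) :
    P.real {ω | a ≤ ∑ i ∈ Finset.range n, Y i ω} ≤
      Real.exp (n * ((Real.exp t - 1) * q) - t * a) := by
  have h1 := measure_ge_le_exp_mul_mgf (X := ∑ i ∈ Finset.range n, Y i) (μ := P) a ht
    (integrable_exp_sum hYm hY n t)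
  simp only [Finset.sum_apply] at h1
  refine h1.trans ?_
  rw [sub_eq_neg_add, Real.exp_add, neg_mul]
  gcongr
  exact mgf_sum_le_exp hYi hYm hY hq n t

lemma measure_sum_le_le_exp (hYi : iIndepFun Y P) (hYm : ∀ i, Measurable (Y i))
    (hY : ∀ i ω, Y i ω ∈ Icc (0 : ℝ) 1) {q : ℝ} (hq : ∀ i, ∫ ω, Y i ω ∂P = q) (n : ℕ) {t : ℝ}
    (ht : t ≤ 0) (a : ℝ) :
    P.real {ω | ∑ i ∈ Finset.range n, Y i ω ≤ a} ≤
      Real.exp (n * ((Real.exp t - 1) * q) - t * a) := by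
  have h1 := measure_le_le_exp_mul_mgf (X := ∑ i ∈ Finset.range n, Y i) (μ := P) a ht
    (integrable_exp_sum hYm hY n t)
  simp only [Finset.sum_apply] at h1
  refine h1.trans ?_
  rw [sub_eq_neg_add, Real.exp_add, neg_mul]
  gcongr
  exact mgf_sum_le_exp hYi hYm hY hq n t

/-- The Chernoff exponent vanishes at `0` with slope `b - a`, so it is positive at small `t` of the
same sign as `b - a`. -/
lemma hasDerivAt_exp_rate (a b : ℝ) :
    HasDerivAt (fun t => t * b - (Real.exp t - 1) * a) (b - a) 0 := by
  have h1 : HasDerivAt (fun t : ℝ => (Real.exp t - 1) * a) (Real.exp 0 * a) 0 :=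
    ((Real.hasDerivAt_exp 0).sub_const 1).mul_const a
  have h2 : HasDerivAt (fun t : ℝ => t * b) (1 * b) 0 := (hasDerivAt_id 0).mul_const b
  convert! h2.sub h1 using 1
  simp

lemma exists_pos_exp_rate {a b : ℝ} (hab : a < b) : ∃ t > 0, 0 < t * b - (Real.exp t - 1) * a := by
  have h1 := (hasDerivAt_exp_rate a b).tendsto_slope_zero_right.eventually
    (lt_mem_nhds (sub_pos.2 hab))
  obtain ⟨t, ht, ht0⟩ := (h1.and self_mem_nhdsWithin).exists
  have ht0 : 0 < t := ht0
  refine ⟨t, ht0, ?_⟩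
  simpa [ht0] using ht

lemma exists_neg_exp_rate {a b : ℝ} (hab : b < a) : ∃ t < 0, 0 < t * b - (Real.exp t - 1) * a := by
  have h1 := (hasDerivAt_exp_rate a b).tendsto_slope_zero_left.eventually
    (gt_mem_nhds (sub_neg.2 hab))
  obtain ⟨t, ht, ht0⟩ := (h1.and self_mem_nhdsWithin).exists
  have ht0 : t < 0 := ht0
  refine ⟨t, ht0, ?_⟩
  have h2 : t⁻¹ < 0 := inv_lt_zero.2 ht0
  simp only [zero_add, zero_mul, Real.exp_zero, sub_self, sub_zero, smul_eq_mul] at ht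
  exact pos_of_mul_neg_right ht h2.le

lemma ae_eventually_notMem_of_eventually_le {s : ℕ → Set Ω} {C : ℝ}
    (hs : ∀ᶠ n : ℕ in atTop, P.real (s n) ≤ C * (1 / (n : ℝ) ^ 2)) :
    ∀ᵐ ω ∂P, ∀ᶠ n in atTop, ω ∉ s n := by
  obtain ⟨N, hN⟩ := eventually_atTop.1 hs
  have hsum : Summable fun n : ℕ => C * (1 / ((n + N : ℕ) : ℝ) ^ 2) :=
    ((summable_nat_add_iff N).2 (Real.summable_one_div_nat_pow.2 one_lt_two)).mul_left C
  have hfin : ∑' n, P (s (n + N)) ≠ ∞ := by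
    refine ne_top_of_le_ne_top hsum.tsum_ofReal_ne_top (ENNReal.tsum_le_tsum fun n => ?_)
    rw [← ofReal_measureReal]
    exact ENNReal.ofReal_le_ofReal (hN _ (by omega))
  filter_upwards [ae_eventually_notMem hfin] with ω hω
  obtain ⟨N', hN'⟩ := eventually_atTop.1 hω
  refine eventually_atTop.2 ⟨N' + N, fun n hn => ?_⟩
  have := hN' (n - N) (by omega)
  rwa [Nat.sub_add_cancel (by omega)] at this

end Concentration

/-! ### Tail bounds for the estimator. -/

section Estimator

variable {d m : ℕ} {Ω : Type*} [MeasurableSpace Ω] {P : Measure Ω}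
  {X : ℕ → Ω → EuclideanSpace ℝ (Fin d)} {Q : Measure (EuclideanSpace ℝ (Fin d))}

lemma integral_gaussKernel_comp (hXm : ∀ i, Measurable (X i)) (hXQ : ∀ i, P.map (X i) = Q)
    {h : ℝ} (hh : 0 < h) (x : EuclideanSpace ℝ (Fin d)) (i : ℕ) :
    ∫ ω, gaussKernel m (‖x - X i ω‖ / h) ∂P = h ^ m * kernelMean m Q h x := by
  have hc : Continuous fun y : EuclideanSpace ℝ (Fin d) => scaledKernel m h (dist x y) :=
    continuous_scaledKernel.comp (by fun_prop)
  rw [← hXQ i, kernelMean, integral_map (hXm i).aemeasurable hc.aestronglyMeasurable,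
    ← integral_const_mul]
  refine integral_congr_ae (Eventually.of_forall fun ω => ?_)
  simp only [scaledKernel, dist_eq_norm]
  field_simp

lemma iIndepFun_gaussKernel_comp (hXi : iIndepFun X P) (h : ℝ) (x : EuclideanSpace ℝ (Fin d)) :
    iIndepFun (fun i ω => gaussKernel m (‖x - X i ω‖ / h)) P :=
  hXi.comp (fun _ y => gaussKernel m (‖x - y‖ / h)) fun _ =>
    ((continuous_gaussKernel m).comp (by fun_prop)).measurable

lemma measurable_gaussKernel_comp (hXm : ∀ i, Measurable (X i)) (h : ℝ)
    (x : EuclideanSpace ℝ (Fin d)) (i : ℕ) :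
    Measurable fun ω => gaussKernel m (‖x - X i ω‖ / h) :=
  (continuous_gaussKernel m).measurable.comp (((measurable_const.sub (hXm i)).norm).div_const h)

lemma le_kernelEstimator_iff {n : ℕ} (hn : 0 < n) {h : ℝ} (hh : 0 < h)
    (y : ℕ → EuclideanSpace ℝ (Fin d)) (x : EuclideanSpace ℝ (Fin d)) (b : ℝ) :
    b ≤ kernelEstimator m n h y x ↔
      n * h ^ m * b ≤ ∑ i ∈ Finset.range n, gaussKernel m (‖x - y i‖ / h) := by
  have : 0 < n * h ^ m := by positivity
  rw [kernelEstimator, one_div, le_inv_mul_iff₀ this]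

lemma kernelEstimator_le_iff {n : ℕ} (hn : 0 < n) {h : ℝ} (hh : 0 < h)
    (y : ℕ → EuclideanSpace ℝ (Fin d)) (x : EuclideanSpace ℝ (Fin d)) (b : ℝ) :
    kernelEstimator m n h y x ≤ b ↔
      ∑ i ∈ Finset.range n, gaussKernel m (‖x - y i‖ / h) ≤ n * h ^ m * b := by
  have : 0 < n * h ^ m := by positivity
  rw [kernelEstimator, one_div, inv_mul_le_iff₀ this]

variable [IsProbabilityMeasure P]

lemma measure_kernelEstimator_ge (hXm : ∀ i, Measurable (X i)) (hXi : iIndepFun X P)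
    (hXQ : ∀ i, P.map (X i) = Q) {n : ℕ} (hn : 0 < n) {h : ℝ} (hh : 0 < h)
    {x : EuclideanSpace ℝ (Fin d)} {a b t : ℝ} (ha : kernelMean m Q h x ≤ a) (ht : 0 ≤ t) :
    P.real {ω | b ≤ kernelEstimator m n h (fun i => X i ω) x} ≤
      Real.exp (-((t * b - (Real.exp t - 1) * a) * (n * h ^ m))) := by
  simp_rw [le_kernelEstimator_iff hn hh]
  refine (measure_sum_ge_le_exp (iIndepFun_gaussKernel_comp hXi h x)
    (measurable_gaussKernel_comp hXm h x)
    (fun i ω => ⟨gaussKernel_nonneg _ _, gaussKernel_le_one _ _⟩)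
    (integral_gaussKernel_comp hXm hXQ hh x) n ht _).trans ?_
  rw [Real.exp_le_exp]
  have h1 : 0 ≤ Real.exp t - 1 := sub_nonneg.2 (Real.one_le_exp ht)
  have h2 : n * h ^ m * ((Real.exp t - 1) * kernelMean m Q h x) ≤
      n * h ^ m * ((Real.exp t - 1) * a) := by gcongr
  linarith

lemma measure_kernelEstimator_le (hXm : ∀ i, Measurable (X i)) (hXi : iIndepFun X P)
    (hXQ : ∀ i, P.map (X i) = Q) {n : ℕ} (hn : 0 < n) {h : ℝ} (hh : 0 < h)
    {x : EuclideanSpace ℝ (Fin d)} {a b t : ℝ} (ha : a ≤ kernelMean m Q h x) (ht : t ≤ 0) :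
    P.real {ω | kernelEstimator m n h (fun i => X i ω) x ≤ b} ≤
      Real.exp (-((t * b - (Real.exp t - 1) * a) * (n * h ^ m))) := by
  simp_rw [kernelEstimator_le_iff hn hh]
  refine (measure_sum_le_le_exp (iIndepFun_gaussKernel_comp hXi h x)
    (measurable_gaussKernel_comp hXm h x)
    (fun i ω => ⟨gaussKernel_nonneg _ _, gaussKernel_le_one _ _⟩)
    (integral_gaussKernel_comp hXm hXQ hh x) n ht _).trans ?_
  rw [Real.exp_le_exp]
  have h1 : 0 ≤ 1 - Real.exp t := sub_nonneg.2 (Real.exp_le_one_iff.2 ht)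
  have h2 : n * h ^ m * ((1 - Real.exp t) * a) ≤
      n * h ^ m * ((1 - Real.exp t) * kernelMean m Q h x) := by gcongr
  linarith

/-- Exponential bounds in `n h^m` are smaller than any power of `n`. -/
lemma eventually_exp_neg_le {h : ℕ → ℝ}
    (hrate : Tendsto (fun n : ℕ => (n : ℝ) * h n ^ m / Real.log n) atTop atTop) {c : ℝ}
    (hc : 0 < c) (k : ℕ) :
    ∀ᶠ n : ℕ in atTop, Real.exp (-(c * (n * h n ^ m))) ≤ 1 / (n : ℝ) ^ k := by
  filter_upwards [hrate.eventually_ge_atTop (k / c), eventually_ge_atTop 2] with n hn hn2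
  have hn2' : (2 : ℝ) ≤ n := by exact_mod_cast hn2
  have hlog : 0 < Real.log n := Real.log_pos (by linarith)
  rw [div_le_div_iff₀ hc hlog] at hn
  have h1 : 1 / (n : ℝ) ^ k = Real.exp (-(k * Real.log n)) := by
    rw [Real.exp_neg, Real.exp_nat_mul, Real.exp_log (by linarith), one_div]
  rw [h1, Real.exp_le_exp]
  linarith

/-- Simultaneous upper bounds on finite sets of polynomial size. -/
lemma ae_eventually_kernelEstimator_lt (hXm : ∀ i, Measurable (X i)) (hXi : iIndepFun X P)
    (hXQ : ∀ i, P.map (X i) = Q) {h : ℕ → ℝ} (hh : ∀ n, 0 < h n)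
    (hrate : Tendsto (fun n : ℕ => (n : ℝ) * h n ^ m / Real.log n) atTop atTop)
    {S : ℕ → Finset (EuclideanSpace ℝ (Fin d))} {C : ℝ} {k : ℕ}
    (hS : ∀ n, ((S n).card : ℝ) ≤ C * (n : ℝ) ^ k) {a b : ℝ} (hab : a < b)
    (hmean : ∀ᶠ n in atTop, ∀ s ∈ S n, kernelMean m Q (h n) s ≤ a) :
    ∀ᵐ ω ∂P, ∀ᶠ n in atTop, ∀ s ∈ S n,
      kernelEstimator m n (h n) (fun i => X i ω) s < b := by
  obtain ⟨t, ht, hrt⟩ := exists_pos_exp_rate hab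
  have hbad : ∀ᶠ n : ℕ in atTop,
      P.real (⋃ s ∈ S n, {ω | b ≤ kernelEstimator m n (h n) (fun i => X i ω) s}) ≤
        C * (1 / (n : ℝ) ^ 2) := by
    -- The power `k + 2` absorbs the `n ^ k` points of the union and leaves a summable `n ^ (-2)`.
    filter_upwards [hmean, eventually_exp_neg_le hrate hrt (k + 2), eventually_gt_atTop 0]
      with n hn1 hn2 hn0
    have hn0' : (0 : ℝ) < n := by exact_mod_cast hn0
    calc _ ≤ ∑ s ∈ S n, P.real {ω | b ≤ kernelEstimator m n (h n) (fun i => X i ω) s} :=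
          measureReal_biUnion_finset_le _ _
      _ ≤ ∑ _s ∈ S n, 1 / (n : ℝ) ^ (k + 2) := Finset.sum_le_sum fun s hs =>
          (measure_kernelEstimator_ge hXm hXi hXQ hn0 (hh n) (hn1 s hs) ht.le).trans hn2
      _ = (S n).card * (1 / (n : ℝ) ^ (k + 2)) := by simp
      _ ≤ C * (n : ℝ) ^ k * (1 / (n : ℝ) ^ (k + 2)) := by gcongr; exact hS n
      _ = C * (1 / (n : ℝ) ^ 2) := by rw [pow_add]; field_simp
  filter_upwards [ae_eventually_notMem_of_eventually_le hbad] with ω hω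
  filter_upwards [hω] with n hn s hs
  by_contra! hcon
  exact hn (mem_iUnion₂.2 ⟨s, hs, hcon⟩)

lemma ae_eventually_lt_kernelEstimator (hXm : ∀ i, Measurable (X i)) (hXi : iIndepFun X P)
    (hXQ : ∀ i, P.map (X i) = Q) {h : ℕ → ℝ} (hh : ∀ n, 0 < h n)
    (hrate : Tendsto (fun n : ℕ => (n : ℝ) * h n ^ m / Real.log n) atTop atTop)
    {s : EuclideanSpace ℝ (Fin d)} {a b : ℝ} (hab : b < a)
    (hmean : ∀ᶠ n in atTop, a ≤ kernelMean m Q (h n) s) :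
    ∀ᵐ ω ∂P, ∀ᶠ n in atTop, b < kernelEstimator m n (h n) (fun i => X i ω) s := by
  obtain ⟨t, ht, hrt⟩ := exists_neg_exp_rate hab
  have hbad : ∀ᶠ n : ℕ in atTop,
      P.real {ω | kernelEstimator m n (h n) (fun i => X i ω) s ≤ b} ≤ 1 * (1 / (n : ℝ) ^ 2) := by
    filter_upwards [hmean, eventually_exp_neg_le hrate hrt 2, eventually_gt_atTop 0]
      with n hn1 hn2 hn0
    rw [one_mul]
    exact (measure_kernelEstimator_le hXm hXi hXQ hn0 (hh n) hn1 ht.le).trans hn2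
  filter_upwards [ae_eventually_notMem_of_eventually_le hbad] with ω hω
  filter_upwards [hω] with n hn
  exact not_le.1 hn

end Estimator

/-! ### Lipschitz control and finite nets. -/

section Net

variable {d m : ℕ}

lemma abs_gaussKernel_sub_le (m : ℕ) (s t : ℝ) :
    |gaussKernel m s - gaussKernel m t| ≤ |s - t| := by
  have hd : ∀ x, HasDerivAt (gaussKernel m)
      (Real.pi ^ (-(m : ℝ) / 2) * (Real.exp (-x ^ 2) * (-(2 * x)))) x := by
    intro x
    have h1 : HasDerivAt (fun x : ℝ => -x ^ 2) (-(2 * x)) x := by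
      convert! (hasDerivAt_pow 2 x).neg using 1
      simp
    exact h1.exp.const_mul _
  have hb : ∀ x ∈ univ, ‖Real.pi ^ (-(m : ℝ) / 2) * (Real.exp (-x ^ 2) * (-(2 * x)))‖ ≤ 1 := by
    intro x _
    have h1 : Real.pi ^ (-(m : ℝ) / 2) ≤ 1 :=
      Real.rpow_le_one_of_one_le_of_nonpos (by linarith [Real.pi_gt_three])
        (by have : (0 : ℝ) ≤ m := Nat.cast_nonneg m
            linarith)
    rw [norm_mul, norm_mul, norm_neg, Real.norm_of_nonneg (by positivity),
      Real.norm_of_nonneg (Real.exp_pos _).le, Real.exp_neg, Real.norm_eq_abs]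
    refine mul_le_one₀ h1 (by positivity) ?_
    rw [inv_mul_le_iff₀ (Real.exp_pos _), mul_one]
    -- This is `|2x| ≤ x² + 1 ≤ exp (x²)`.
    refine le_trans ?_ (Real.add_one_le_exp _)
    rw [abs_le]
    constructor <;> nlinarith [sq_nonneg (x - 1), sq_nonneg (x + 1)]
  simpa using convex_univ.norm_image_sub_le_of_norm_hasDerivWithin_le
    (fun x _ => (hd x).hasDerivWithinAt) hb (mem_univ t) (mem_univ s)

/-- The Lipschitz constant `h^(-(m+1))` does not depend on the sample, so one net serves all
outcomes. -/
lemma kernelEstimator_le_add {n : ℕ} (hn : 0 < n) {h : ℝ} (hh : 0 < h)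
    (y : ℕ → EuclideanSpace ℝ (Fin d)) (x s : EuclideanSpace ℝ (Fin d)) :
    kernelEstimator m n h y x ≤ kernelEstimator m n h y s + dist x s / h ^ (m + 1) := by
  have hn' : (0 : ℝ) < n := by exact_mod_cast hn
  have h1 : ∑ i ∈ Finset.range n, gaussKernel m (‖x - y i‖ / h) ≤
      ∑ i ∈ Finset.range n, (gaussKernel m (‖s - y i‖ / h) + dist x s / h) := by
    refine Finset.sum_le_sum fun i _ => ?_
    have h2 := (le_abs_self _).trans
      (abs_gaussKernel_sub_le m (‖x - y i‖ / h) (‖s - y i‖ / h))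
    have h3 : |‖x - y i‖ / h - ‖s - y i‖ / h| ≤ dist x s / h := by
      rw [← sub_div, abs_div, abs_of_pos hh]
      gcongr
      have := abs_norm_sub_norm_le (x - y i) (s - y i)
      rwa [sub_sub_sub_cancel_right, ← dist_eq_norm] at this
    linarith
  calc _ ≤ 1 / (n * h ^ m) *
        ∑ i ∈ Finset.range n, (gaussKernel m (‖s - y i‖ / h) + dist x s / h) := by
        unfold kernelEstimator; gcongr
    _ = _ := by
        unfold kernelEstimator
        rw [Finset.sum_add_distrib, mul_add, Finset.sum_const, Finset.card_range, nsmul_eq_mul]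
        congr 1
        field_simp
        ring

/-- A bounded set has a net of mesh `√d / k` with at most `(2 R k + 1) ^ d` points. -/
lemma exists_finset_net {R : ℕ} {T : Set (EuclideanSpace ℝ (Fin d))}
    (hT : T ⊆ Metric.closedBall 0 R) {k : ℕ} (hk : 0 < k) :
    ∃ S : Finset (EuclideanSpace ℝ (Fin d)), (S : Set _) ⊆ T ∧ S.card ≤ (2 * R * k + 1) ^ d ∧
      ∀ x ∈ T, ∃ s ∈ S, dist x s ≤ √d / k := by
  classical
  have hk' : (0 : ℝ) < k := by exact_mod_cast hk
  set cell : EuclideanSpace ℝ (Fin d) → Fin d → ℤ := fun x i => ⌊k * x i⌋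
  set F : Finset (Fin d → ℤ) := Fintype.piFinset fun _ => Finset.Icc (-(R * k : ℤ)) (R * k)
  have hcell : ∀ x ∈ T, cell x ∈ F := by
    intro x hx
    refine Fintype.mem_piFinset.2 fun i => Finset.mem_Icc.2 ?_
    have h1 : |x i| ≤ R := by
      have h2 := PiLp.norm_apply_le x i
      rw [Real.norm_eq_abs] at h2
      exact h2.trans (mem_closedBall_zero_iff.1 (hT hx))
    obtain ⟨h2, h3⟩ := abs_le.1 h1
    constructor
    · rw [Int.le_floor]
      push_cast
      nlinarith
    · refine Int.floor_le_iff.2 ?_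
      push_cast
      nlinarith
  -- One point of `T` per occupied cell of side `1 / k`: the net lies in `T` itself, where bounds on
  -- `f` hold.
  obtain ⟨S, hST, hbij⟩ := exists_subset_bijOn T cell
  have hSF : cell '' S ⊆ F := by
    rintro _ ⟨x, hx, rfl⟩
    exact hcell x (hST hx)
  have hfin : S.Finite := Finite.of_finite_image (F.finite_toSet.subset hSF) hbij.injOn
  refine ⟨hfin.toFinset, by simpa using hST, ?_, fun x hx => ?_⟩
  · have hcard : hfin.toFinset.card ≤ F.card :=
      Finset.card_le_card_of_injOn cell (fun x hx => hcell x (hST (by simpa using hx)))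
        (by simpa using hbij.injOn)
    refine hcard.trans (le_of_eq ?_)
    rw [Fintype.card_piFinset_const, Int.card_Icc]
    congr 1
    have : (R * k : ℤ) + 1 - -(R * k : ℤ) = ((2 * R * k + 1 : ℕ) : ℤ) := by push_cast; ring
    rw [this, Int.toNat_natCast]
  · obtain ⟨s, hs, hsx⟩ := hbij.surjOn (mem_image_of_mem cell hx)
    refine ⟨s, by simpa using hs, ?_⟩
    rw [EuclideanSpace.dist_eq]
    have h1 : ∀ i, dist (x i) (s i) ^ 2 ≤ (1 / k : ℝ) ^ 2 := by
      intro i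
      have h2 : |k * x i - k * s i| < 1 := Int.abs_sub_lt_one_of_floor_eq_floor
        (congrFun hsx i).symm
      rw [← mul_sub, abs_mul, abs_of_pos hk'] at h2
      gcongr
      rw [Real.dist_eq, le_div_iff₀ hk']
      linarith
    calc _ ≤ √(∑ _i : Fin d, (1 / k : ℝ) ^ 2) := Real.sqrt_le_sqrt (Finset.sum_le_sum fun i _ => h1 i)
      _ = √d / k := by
        rw [Finset.sum_const, Finset.card_univ, Fintype.card_fin, nsmul_eq_mul,
          Real.sqrt_mul (Nat.cast_nonneg d), Real.sqrt_sq (by positivity)]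
        ring

lemma finite_of_isC2Submanifold_zero {M : Set (EuclideanSpace ℝ (Fin d))}
    (hM : IsC2Submanifold 0 M) (hMc : IsCompact M) : M.Finite := by
  refine hMc.induction_on (p := Set.Finite) finite_empty (fun s t hst ht => ht.subset hst)
    (fun s t hs ht => hs.union ht) fun x hx => ?_
  obtain ⟨Φ, hΦ⟩ := hM.exists_chart x hx
  refine ⟨M ∩ Φ.source, inter_mem self_mem_nhdsWithin
    (nhdsWithin_le_nhds (Φ.open_source.mem_nhds hΦ.mem_source)), ?_⟩
  have hz : ∀ y ∈ M ∩ Φ.source, Φ y = 0 := by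
    rintro y ⟨hyM, hys⟩
    ext i
    exact ((hΦ.mem_iff y hys).2 hyM).1 i (Nat.zero_le _)
  refine Finite.of_finite_image ((finite_singleton 0).subset ?_)
    (Φ.injOn.mono inter_subset_right)
  rintro _ ⟨y, hy, rfl⟩
  exact hz y hy

/-- Finite sets of polynomial size that control the kernel estimators on `T ⊆ M`. -/
lemma exists_controlling_finsets {M T : Set (EuclideanSpace ℝ (Fin d))}
    (hM : IsC2Submanifold m M) (hMc : IsCompact M) (hT : T ⊆ M) {h : ℕ → ℝ}
    (hh : ∀ n, 0 < h n) (hh0 : Tendsto h atTop (𝓝 0))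
    (hrate : Tendsto (fun n : ℕ => (n : ℝ) * h n ^ m / Real.log n) atTop atTop) :
    ∃ (S : ℕ → Finset (EuclideanSpace ℝ (Fin d))) (C : ℝ) (k : ℕ),
      (∀ n, (S n : Set _) ⊆ T) ∧ (∀ n, ((S n).card : ℝ) ≤ C * (n : ℝ) ^ k) ∧
      ∀ ε > 0, ∀ᶠ n in atTop, ∀ y : ℕ → EuclideanSpace ℝ (Fin d), ∀ x ∈ T, ∃ s ∈ S n,
        kernelEstimator m n (h n) y x ≤ kernelEstimator m n (h n) y s + ε := by
  -- For `m = 0` the rate gives no lower bound on `h n`, but `M` is finite and `T` is its own net.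
  rcases Nat.eq_zero_or_pos m with rfl | hm
  · have hfin := (finite_of_isC2Submanifold_zero hM hMc).subset hT
    refine ⟨fun _ => hfin.toFinset, hfin.toFinset.card, 0, by simp, by simp, fun ε hε =>
      Eventually.of_forall fun n y x hx => ⟨x, by simpa using hx, by linarith⟩⟩
  obtain ⟨R₀, hR₀⟩ := hMc.isBounded.subset_closedBall 0
  have hR : T ⊆ Metric.closedBall 0 (⌈R₀⌉₊ : ℕ) :=
    hT.trans (hR₀.trans (Metric.closedBall_subset_closedBall (Nat.le_ceil _)))
  set R := ⌈R₀⌉₊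
  -- Mesh `√d / n ^ 3` suffices: eventually `n * h ^ m ≥ 1` and `n * h ≥ 1`, so `h^(-(m+1)) ≤ n ^ 2`
  -- and the error is at most `√d / n`.
  have hnet : ∀ n : ℕ, ∃ S : Finset (EuclideanSpace ℝ (Fin d)), (S : Set _) ⊆ T ∧
      (S.card : ℝ) ≤ (2 * R + 1 : ℝ) ^ d * (n : ℝ) ^ (3 * d) ∧
      (0 < n → ∀ x ∈ T, ∃ s ∈ S, dist x s ≤ √d / (n : ℝ) ^ 3) := by
    intro n
    rcases Nat.eq_zero_or_pos n with rfl | hn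
    · exact ⟨∅, by simp, by simp; positivity, by simp⟩
    · obtain ⟨S, h1, h2, h3⟩ := exists_finset_net hR (pow_pos hn 3)
      refine ⟨S, h1, ?_, fun _ => by simpa using h3⟩
      have h4 : (2 * R * n ^ 3 + 1) ^ d ≤ ((2 * R + 1) * n ^ 3) ^ d := by
        gcongr
        have : 1 ≤ n ^ 3 := Nat.one_le_pow _ _ hn
        linarith
      rw [pow_mul, ← mul_pow]
      exact_mod_cast h2.trans h4
  choose S hST hcard hdist using hnet
  refine ⟨S, _, _, hST, hcard, fun ε hε => ?_⟩
  have hsmall : ∀ᶠ n : ℕ in atTop, √d / (n : ℝ) < ε :=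
    (tendsto_const_div_atTop_nhds_zero_nat (√d)).eventually (gt_mem_nhds hε)
  filter_upwards [hsmall, hh0.eventually (gt_mem_nhds one_pos), hrate.eventually_ge_atTop 2,
    eventually_ge_atTop 2] with n hn1 hn2 hn3 hn4 y x hx
  have hn4' : (2 : ℝ) ≤ n := by exact_mod_cast hn4
  obtain ⟨s, hs, hxs⟩ := hdist n (by omega) x hx
  refine ⟨s, hs, (kernelEstimator_le_add (by omega) (hh n) y x s).trans ?_⟩
  gcongr
  have hpos : 0 < h n := hh n
  have hlog : 1 / 2 ≤ Real.log n := by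
    have h1 := Real.log_le_log two_pos hn4'
    linarith [Real.log_two_gt_d9]
  have hnh : 1 ≤ n * h n ^ m := by
    rw [le_div_iff₀ (by linarith)] at hn3
    linarith
  have hh1 : 1 ≤ n * h n := by
    refine hnh.trans ?_
    gcongr
    exact pow_le_of_le_one hpos.le hn2.le (by omega)
  have hprod : 1 ≤ (n : ℝ) ^ 2 * h n ^ (m + 1) := by
    calc (1 : ℝ) = 1 * 1 := (one_mul _).symm
      _ ≤ (n * h n ^ m) * (n * h n) := by gcongr
      _ = _ := by ring
  calc dist x s / h n ^ (m + 1) ≤ √d / (n : ℝ) ^ 3 / h n ^ (m + 1) := by gcongr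
    _ = √d / n / ((n : ℝ) ^ 2 * h n ^ (m + 1)) := by field_simp
    _ ≤ √d / n := div_le_self (by positivity) hprod
    _ ≤ ε := hn1.le

end Net

/-! ### Almost sure bounds and the conclusion. -/

section Consistency

variable {d m : ℕ} {M : Set (EuclideanSpace ℝ (Fin d))} {f : EuclideanSpace ℝ (Fin d) → ℝ}
  {Ω : Type*} [MeasurableSpace Ω] {P : Measure Ω} [IsProbabilityMeasure P]
  {X : ℕ → Ω → EuclideanSpace ℝ (Fin d)} {h : ℕ → ℝ}

/-- The estimator eventually stays below the level, uniformly where the density is well below. -/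
lemma ae_eventually_kernelEstimator_lt_of_le (hM : IsC2Submanifold m M) (hMc : IsCompact M)
    (hf : ContinuousOn f M) (hf0 : ∀ x ∈ M, 0 ≤ f x)
    (hXm : ∀ i, Measurable (X i)) (hXi : iIndepFun X P)
    (hXf : ∀ i, P.map (X i) = (volumeOn m M).withDensity (fun x => ENNReal.ofReal (f x)))
    (hh : ∀ n, 0 < h n) (hh0 : Tendsto h atTop (𝓝 0))
    (hrate : Tendsto (fun n : ℕ => (n : ℝ) * h n ^ m / Real.log n) atTop atTop)
    (lam : ℝ) {ε : ℝ} (hε : 0 < ε) :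
    ∀ᵐ ω ∂P, ∀ᶠ n in atTop, ∀ x ∈ M, f x ≤ lam - ε →
      kernelEstimator m n (h n) (fun i => X i ω) x < lam := by
  have : IsProbabilityMeasure (P.map (X 0)) :=
    Measure.isProbabilityMeasure_map (hXm 0).aemeasurable
  obtain ⟨S, C, k, hST, hcard, hctrl⟩ := exists_controlling_finsets
    (T := {x | x ∈ M ∧ f x ≤ lam - ε}) hM hMc (fun x hx => hx.1) hh hh0 hrate
  have hh0' : Tendsto h atTop (𝓝[>] 0) :=
    tendsto_nhdsWithin_iff.2 ⟨hh0, Eventually.of_forall hh⟩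
  -- Of the gap `ε`, half goes to the bias, a quarter to the fluctuation on the net, a quarter to
  -- leaving the net.
  have hmean : ∀ᶠ n in atTop, ∀ s ∈ S n, kernelMean m (P.map (X 0)) (h n) s ≤ lam - ε / 2 := by
    filter_upwards [hh0'.eventually (eventually_kernelMean_le hM hMc hf hf0 (hXf 0)
      (half_pos hε))] with n hn s hs
    have h1 := hST n hs
    linarith [hn s h1.1, h1.2]
  filter_upwards [ae_eventually_kernelEstimator_lt hXm hXi
    (fun i => (hXf i).trans (hXf 0).symm) hh hrate hcard
    (show lam - ε / 2 < lam - ε / 4 by linarith) hmean] with ω hω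
  filter_upwards [hω, hctrl (ε / 4) (by positivity)] with n hn1 hn2 x hx hfx
  obtain ⟨s, hs, hxs⟩ := hn2 (fun i => X i ω) x ⟨hx, hfx⟩
  linarith [hn1 s hs]

/-- At an interior point with density above the level, the estimator is eventually above it. -/
lemma ae_eventually_le_kernelEstimator (hM : IsC2Submanifold m M) (hMc : IsCompact M)
    (hf : ContinuousOn f M) (hXm : ∀ i, Measurable (X i)) (hXi : iIndepFun X P)
    (hXf : ∀ i, P.map (X i) = (volumeOn m M).withDensity (fun x => ENNReal.ofReal (f x)))
    (hh : ∀ n, 0 < h n) (hh0 : Tendsto h atTop (𝓝 0))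
    (hrate : Tendsto (fun n : ℕ => (n : ℝ) * h n ^ m / Real.log n) atTop atTop)
    {lam : ℝ} (hlam : 0 < lam) {a : EuclideanSpace ℝ (Fin d)} (ha : a ∈ manifoldInterior m M)
    (hfa : lam < f a) :
    ∀ᵐ ω ∂P, ∀ᶠ n in atTop, lam ≤ kernelEstimator m n (h n) (fun i => X i ω) a := by
  have : IsProbabilityMeasure (P.map (X 0)) :=
    Measure.isProbabilityMeasure_map (hXm 0).aemeasurable
  have hh0' : Tendsto h atTop (𝓝[>] 0) :=
    tendsto_nhdsWithin_iff.2 ⟨hh0, Eventually.of_forall hh⟩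
  obtain ⟨b, hb1, hb2⟩ := exists_between hfa
  filter_upwards [ae_eventually_lt_kernelEstimator hXm hXi
    (fun i => (hXf i).trans (hXf 0).symm) hh hrate hb1
    (hh0'.eventually (eventually_le_kernelMean hM hMc hf (hXf 0) ha (hlam.trans hfa) hb2))]
    with ω hω
  exact hω.mono fun n hn => hn.le

lemma tendsto_rate_div_log {β : ℕ → ℝ} (hh : ∀ n, 0 < h n) (hβ : Tendsto β atTop atTop)
    (hnh : Tendsto (fun n : ℕ => (n : ℝ) * h n ^ m / (β n ^ 2 * Real.log n)) atTop atTop) :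
    Tendsto (fun n : ℕ => (n : ℝ) * h n ^ m / Real.log n) atTop atTop := by
  refine tendsto_atTop_mono' _ ?_ hnh
  filter_upwards [hβ.eventually_ge_atTop 1, eventually_ge_atTop 2] with n hn hn2
  have hlog : 0 < Real.log n := Real.log_pos (by exact_mod_cast hn2)
  have := hh n
  gcongr
  exact le_mul_of_one_le_left hlog.le (one_le_pow₀ hn)

end Consistency

end ManifoldDensity

theorem theorem4 {d m : ℕ} (M : Set (EuclideanSpace ℝ (Fin d)))
    (hM : ManifoldDensity.IsC2Submanifold m M) (hMc : IsCompact M)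
    (f : EuclideanSpace ℝ (Fin d) → ℝ)
    (hf : ManifoldDensity.IsC2On M f) (hf0 : ∀ x ∈ M, 0 ≤ f x)
    {Ω : Type*} [MeasurableSpace Ω] (P : Measure Ω) [IsProbabilityMeasure P]
    -- an iid sample from the law on `M` whose density with respect to the volume of `M` is `f`
    (X : ℕ → Ω → EuclideanSpace ℝ (Fin d))
    (hXm : ∀ i, Measurable (X i)) (hXi : iIndepFun X P)
    (hXf : ∀ i, P.map (X i) =
      (ManifoldDensity.volumeOn m M).withDensity (fun x => ENNReal.ofReal (f x)))
    (hXs : ∀ i, (P.map (X i)).support = M)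
    -- the bandwidths and the rate sequence
    (h β : ℕ → ℝ) (hh : ∀ n, 0 < h n) (hh0 : Tendsto h atTop (𝓝 0))
    (hβ : Tendsto β atTop atTop)
    (hβh : Tendsto (fun n => β n * h n ^ 2) atTop (𝓝 0))
    (hnh : Tendsto (fun n : ℕ => (n : ℝ) * h n ^ m / (β n ^ 2 * Real.log n)) atTop atTop)
    -- the level
    (lam : ℝ) (hlam : 0 < lam)
    (hlev : ∀ x ∈ M, f x = lam → ∃ a : ℕ → EuclideanSpace ℝ (Fin d),
      (∀ j, a j ∈ ManifoldDensity.manifoldInterior m M) ∧ Tendsto a atTop (𝓝 x) ∧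
      ∀ j, lam < f (a j)) :
    ∀ᵐ ω ∂P, Tendsto (fun n : ℕ => ManifoldDensity.hausdorffDist M
        (ManifoldDensity.levelSet M
          (ManifoldDensity.kernelEstimator m n (h n) (fun i => X i ω)) lam)
        (ManifoldDensity.levelSet M f lam))
      atTop (𝓝 0) := by
  have hfc := hf.continuousOn
  have hrate := ManifoldDensity.tendsto_rate_div_log hh hβ hnh
  set D₀ := ManifoldDensity.manifoldInterior m M ∩ {x | lam < f x}
  -- Countability of `D`, and below of the gaps `1 / (k + 1)`, allows one null set for all the
  -- almost sure statements.
  obtain ⟨D, hDD₀, hDc, hD⟩ :=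
    (TopologicalSpace.IsSeparable.of_separableSpace D₀).exists_countable_dense_subset
  have hlow : ∀ᵐ ω ∂P, ∀ s ∈ D, ∀ᶠ n in atTop,
      lam ≤ ManifoldDensity.kernelEstimator m n (h n) (fun i => X i ω) s :=
    (ae_ball_iff hDc).2 fun s hs => ManifoldDensity.ae_eventually_le_kernelEstimator hM hMc hfc
      hXm hXi hXf hh hh0 hrate hlam (hDD₀ hs).1 (hDD₀ hs).2
  have hupp : ∀ᵐ ω ∂P, ∀ k : ℕ, ∀ᶠ n in atTop, ∀ x ∈ M, f x ≤ lam - 1 / ((k : ℝ) + 1) →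
      ManifoldDensity.kernelEstimator m n (h n) (fun i => X i ω) x < lam :=
    ae_all_iff.2 fun k => ManifoldDensity.ae_eventually_kernelEstimator_lt_of_le hM hMc hfc hf0
      hXm hXi hXf hh hh0 hrate lam (by positivity)
  filter_upwards [hlow, hupp] with ω hω1 hω2
  refine ManifoldDensity.tendsto_hausdorffDist_levelSet hM hMc hfc
    (fun s hs => (hDD₀ hs).1.1)
    ((ManifoldDensity.levelSet_subset_closure hM hfc hlev).trans
      (closure_minimal hD isClosed_closure)) hω1 fun ε hε => ?_
  obtain ⟨k, hk⟩ := exists_nat_one_div_lt hε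
  exact (hω2 k).mono fun n hn x hx hfx => hn x hx (by linarith)
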